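/- Let $n,k,m\in\mathbb N$, let $U\subseteq\mathbb R^m$ be non-empty and closed, and consider $$\dot x=A(y,u)x+b(y,u),\qquad \dot y=f(y,u)+c(y)x,\qquad x\in\mathbb R^n,\ y\in\mathbb R^k,\ u\in U, \tag{1}$$ where $A:\mathbb R^k\times U\to\mathbb R^{n\times n}$, $b:\mathbb R^k\times U\to\mathbb R^n$, $f:\mathbb R^k\times U\to\mathbb R^k$, $c:\mathbb R^k\to\mathbb R^{k\times n}$ are locally Lipschitz. (Here the state space is all of $\mathbb R^n\times\mathbb R^k$.) For an interval $I\subseteq[0,\infty)$, $\mathcal L^\infty(I;U)$ denotes the measurable, essentially bounded functions $I\to U$, and $\mathcal L^\infty_{loc}$ the measurable, locally essentially bounded ones; functions that agree almost everywhere are not identified, and $\sup$ is always the true supremum. Solutions are locally absolutely continuous functions satisfying the equations almost everywhere. Assume that for all $(x_0,y_0)\in\mathbb R^n\times\mathbb R^k$ and $u\in\mathcal L^\infty_{loc}([0,\infty);U)$ system (1) has a unique solution on $[0,\infty)$ with $(x(0),y(0))=(x_0,y_0)$. Fix $r>0$. For $(y,u)\in\mathcal L^\infty([0,r];\mathbb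 R^k)\times\mathcal L^\infty([0,r];U)$ let $\Phi$ be the solution of $\dot\Phi(t)=A(y(t),u(t))\Phi(t)$, $\Phi(0)=I$, on $[0,r]$, and put, for $\tau\in[0,r]$, $$\theta(\tau)=\int_0^\tau\Phi(\tau)\Phi(s)^{-1}b(y(s),u(s))\,ds,\qquad q(\tau)=\int_0^\tau\Phi(s)^{T}c(y(s))^{T}ds,$$ $$p(\tau)=y(\tau)-y(0)-\int_0^\tau f(y(s),u(s))\,ds-\int_0^\tau c(y(s))\theta(s)\,ds,\qquad Q=\int_0^r q(\tau)q(\tau)^{T}d\tau,$$ $$P(y,u)=\Phi(r)\,Q^{-1}\int_0^r q(\tau)p(\tau)\,d\tau+\theta(r),$$ where $Q^{-1}$ is read as $0$ if $Q$ is singular. Assume: (H1) (strong observability in time $r$) for every $u\in\mathcal L^\infty([0,r];U)$ and all $(x_0,y_0)\ne(\xi_0,\eta_0)$, the solutions $(x,y)$, $(\xi,\eta)$ of (1) on $[0,r]$ with input $u$ starting there satisfy $\max_{t\in[0,r]}|y(t)-\eta(t)|>0$. (R1) For all $(x_0,y_0)$ and $u\in\mathcal L^\infty([0,\infty);U)$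 the solution of (1) satisfies $\sup_{t\ge0}|y(t)|+\sup_{t\ge0}|x(t)|<\infty$. (R2) For all sets $B\subset\mathcal L^\infty([0,r];\mathbb R^k)$, $V\subset\mathcal L^\infty([0,r];U)$ that are bounded in the supremum norm, $P(B\times V)$ is bounded, and for every $\varepsilon>0$ there is $\delta>0$ such that $|P(y,u)-P(\hat y,u)|<\varepsilon$ for all $y,\hat y\in B$, $u\in V$ with $\sup_{t\in[0,r]}|y(t)-\hat y(t)|<\delta$. Given a measurement error $e$, put $\tilde y=y+e$, $\tau_i=ir$ $(i=0,1,2,\dots)$, $(\delta_\tau g)(s)=g(\tau+s)$, and consider the observer $$\dot z(t)=A(\tilde y(t),u(t))z(t)+b(\tilde y(t),u(t)),\ t\in[\tau_i,\tau_{i+1}),\qquad z(\tau_{i+1})=P(\delta_{\tau_i}\tilde y,\delta_{\tau_i}u),\qquad z(0)=z_0. \tag{2}$$ Then for every $(x_0,y_0,z_0)\in\mathbb R^n\times\mathbb R^k\times\mathbb R^n$, $u\in\mathcal L^\infty([0,\infty);U)$ and $e\in\mathcal L^\infty([0,\infty);\mathbb R^k)$ the system (1), (2) has a unique solution $(x,y,z)$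 on $[0,\infty)$ with initial condition $(x_0,y_0,z_0)$, and: (a) for every $(x_0,y_0,z_0)$, $u\in\mathcal L^\infty([0,\infty);U)$ and $e\in\mathcal L^\infty([0,\infty);\mathbb R^k)$ with $\sup_{t\ge0}|e(t)|<\infty$, this solution satisfies $\sup_{t\ge0}|z(t)-x(t)|<\infty$; (b) for every $(x_0,y_0,z_0)$, $u\in\mathcal L^\infty([0,\infty);U)$ and $\varepsilon>0$ there is $\delta>0$ such that for every $e\in\mathcal L^\infty([0,\infty);\mathbb R^k)$ with $\sup_{t\ge0}|e(t)|<\delta$ this solution satisfies $\sup_{t\ge r}|z(t)-x(t)|<\varepsilon$; (c) for every $(x_0,y_0,z_0)$, $u\in\mathcal L^\infty([0,\infty);U)$ and $e\in\mathcal L^\infty([0,\infty);\mathbb R^k)$ with $\lim_{t\to\infty}|e(t)|=0$, this solution satisfies $\lim_{t\to\infty}|z(t)-x(t)|=0$. -/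

import Mathlib

open MeasureTheory Set Filter Topology
open scoped ENNReal NNReal

noncomputable section

/-- Euclidean space of dimension `d`, with the Euclidean norm. -/
abbrev Euc (d : ℕ) : Type := EuclideanSpace ℝ (Fin d)

/-- The true (not essential) supremum of `|g(t)|` over `t ∈ I`, as an extended nonnegative real;
it is `⊤` exactly when `g` is unbounded on `I`. -/
def supNormOn {d : ℕ} (I : Set ℝ) (g : ℝ → Euc d) : ℝ≥0∞ := ⨆ t ∈ I, ‖g t‖ₑ

/-- Measurable, essentially bounded functions on `I` with values in `U`. These are honest
functions: two functions that agree almost everywhere are not identified. Functions on `I` are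
represented by functions on `ℝ` whose values outside `I` are irrelevant. -/
def MemLinf {d : ℕ} (I : Set ℝ) (U : Set (Euc d)) (u : ℝ → Euc d) : Prop :=
  MemLp u ∞ (volume.restrict I) ∧ ∀ t ∈ I, u t ∈ U

/-- Measurable, locally essentially bounded functions on `[0, ∞)` with values in `U`. -/
def MemLinfLoc {d : ℕ} (U : Set (Euc d)) (u : ℝ → Euc d) : Prop :=
  ∀ T : ℝ, 0 ≤ T → MemLinf (Icc 0 T) U u

/-- The shifted function `(δ_τ g)(s) = g(τ + s)`. -/
def shift {d : ℕ} (τ : ℝ) (g : ℝ → Euc d) : ℝ → Euc d := fun s => g (τ + s)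

/-- A control system, affine in the unmeasured state `x`, on the whole space `ℝⁿ × ℝᵏ`:
`x' = A(y,u) x + b(y,u)`, `y' = f(y,u) + c(y) x`, with input values in the nonempty closed set
`U ⊆ ℝᵐ` and locally Lipschitz coefficients. Matrices are linear maps between Euclidean spaces;
`c y` is the `k × n` matrix with entries `c_{i,j}(y)`. Values of `A`, `b`, `f` at inputs
outside `U` are irrelevant. -/
structure ControlSystem (n k m : ℕ) where
  U : Set (Euc m)
  A : Euc k → Euc m → (Euc n →L[ℝ] Euc n)
  b : Euc k → Euc m → Euc n
  f : Euc k → Euc m → Euc k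
  c : Euc k → (Euc n →L[ℝ] Euc k)
  U_nonempty : U.Nonempty
  U_closed : IsClosed U
  A_lip : LocallyLipschitzOn (univ ×ˢ U) (fun p : Euc k × Euc m => A p.1 p.2)
  b_lip : LocallyLipschitzOn (univ ×ˢ U) (fun p : Euc k × Euc m => b p.1 p.2)
  f_lip : LocallyLipschitzOn (univ ×ˢ U) (fun p : Euc k × Euc m => f p.1 p.2)
  c_lip : LocallyLipschitz c

namespace ControlSystem

variable {n k m : ℕ}

/-- `(x, y)` is a (Carathéodory) solution of the control system on the interval `J ∋ 0`,
`J ⊆ [0, ∞)`, with input `u` and initial condition `(x₀, y₀)`: it is the integral of the right-hand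
side, i.e. locally absolutely continuous and satisfies the equations for almost every time. -/
def IsSolution (S : ControlSystem n k m) (J : Set ℝ) (u : ℝ → Euc m) (x₀ : Euc n) (y₀ : Euc k)
    (x : ℝ → Euc n) (y : ℝ → Euc k) : Prop :=
  ∀ t ∈ J,
    IntervalIntegrable (fun s => S.A (y s) (u s) (x s) + S.b (y s) (u s)) volume 0 t ∧
    IntervalIntegrable (fun s => S.f (y s) (u s) + S.c (y s) (x s)) volume 0 t ∧
    x t = x₀ + ∫ s in (0 : ℝ)..t, (S.A (y s) (u s) (x s) + S.b (y s) (u s)) ∧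
    y t = y₀ + ∫ s in (0 : ℝ)..t, (S.f (y s) (u s) + S.c (y s) (x s))

/-- Global existence and uniqueness of solutions for all initial conditions and all measurable,
locally essentially bounded inputs. -/
def WellPosed (S : ControlSystem n k m) : Prop :=
  ∀ (x₀ : Euc n) (y₀ : Euc k) (u : ℝ → Euc m), MemLinfLoc S.U u →
    ∃ (x : ℝ → Euc n) (y : ℝ → Euc k), S.IsSolution (Ici 0) u x₀ y₀ x y ∧
      ∀ (x' : ℝ → Euc n) (y' : ℝ → Euc k), S.IsSolution (Ici 0) u x₀ y₀ x' y' →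
        EqOn x' x (Ici 0) ∧ EqOn y' y (Ici 0)

/-- Strong observability in time `r`: for every input on `[0, r]`, the outputs on `[0, r]` that
start from two different states differ at some time of `[0, r]`. -/
def StronglyObservable (S : ControlSystem n k m) (r : ℝ) : Prop :=
  ∀ u : ℝ → Euc m, MemLinf (Icc 0 r) S.U u →
    ∀ (x₀ ξ₀ : Euc n) (y₀ η₀ : Euc k), (x₀, y₀) ≠ (ξ₀, η₀) →
      ∀ (x ξ : ℝ → Euc n) (y η : ℝ → Euc k),
        S.IsSolution (Icc 0 r) u x₀ y₀ x y → S.IsSolution (Icc 0 r) u ξ₀ η₀ ξ η →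
          ∃ t ∈ Icc 0 r, 0 < ‖y t - η t‖

/-- `Φ` solves `Φ' = A(y(t), u(t)) Φ`, `Φ(0) = I` on `[0, r]`. -/
def IsTransition (S : ControlSystem n k m) (r : ℝ) (y : ℝ → Euc k) (u : ℝ → Euc m)
    (Φ : ℝ → (Euc n →L[ℝ] Euc n)) : Prop :=
  ∀ t ∈ Icc 0 r,
    IntervalIntegrable (fun s => S.A (y s) (u s) ∘L Φ s) volume 0 t ∧
    Φ t = ContinuousLinearMap.id ℝ (Euc n) + ∫ s in (0 : ℝ)..t, S.A (y s) (u s) ∘L Φ s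

/-- The transition matrix `Φ(t, y; u)`, `t ∈ [0, r]`, of `z' = A(y(t), u(t)) z`. -/
def transition (S : ControlSystem n k m) (r : ℝ) (y : ℝ → Euc k) (u : ℝ → Euc m) :
    ℝ → (Euc n →L[ℝ] Euc n) :=
  Classical.epsilon (S.IsTransition r y u)

/-- `θ(τ) = ∫₀^τ Φ(τ) Φ(s)⁻¹ b(y(s), u(s)) ds`. -/
def theta (S : ControlSystem n k m) (r : ℝ) (y : ℝ → Euc k) (u : ℝ → Euc m) (τ : ℝ) : Euc n :=
  ∫ s in (0 : ℝ)..τ, S.transition r y u τ ((S.transition r y u s).inverse (S.b (y s) (u s)))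

/-- The `n × k` matrix `q(τ) = ∫₀^τ Φ(s)ᵀ c(y(s))ᵀ ds`. -/
def qMat (S : ControlSystem n k m) (r : ℝ) (y : ℝ → Euc k) (u : ℝ → Euc m) (τ : ℝ) :
    Euc k →L[ℝ] Euc n :=
  ∫ s in (0 : ℝ)..τ, (ContinuousLinearMap.adjoint (S.transition r y u s)) ∘L
    (ContinuousLinearMap.adjoint (S.c (y s)))

/-- `p(τ) = y(τ) - y(0) - ∫₀^τ f(y(s), u(s)) ds - ∫₀^τ c(y(s)) θ(s) ds`. -/
def pVec (S : ControlSystem n k m) (r : ℝ) (y : ℝ → Euc k) (u : ℝ → Euc m) (τ : ℝ) : Euc k :=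
  y τ - y 0 - (∫ s in (0 : ℝ)..τ, S.f (y s) (u s))
    - ∫ s in (0 : ℝ)..τ, S.c (y s) (S.theta r y u s)

/-- The Gram matrix `Q = ∫₀^r q(τ) q(τ)ᵀ dτ`. -/
def gram (S : ControlSystem n k m) (r : ℝ) (y : ℝ → Euc k) (u : ℝ → Euc m) :
    Euc n →L[ℝ] Euc n :=
  ∫ τ in (0 : ℝ)..r, S.qMat r y u τ ∘L ContinuousLinearMap.adjoint (S.qMat r y u τ)

/-- The reconstruction operator `P(y, u) = Φ(r) Q⁻¹ ∫₀^r q(τ) p(τ) dτ + θ(r)`; it reads `y` and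
`u` on `[0, r]` only. (`ContinuousLinearMap.inverse` is zero at a singular matrix.) -/
def recon (S : ControlSystem n k m) (r : ℝ) (y : ℝ → Euc k) (u : ℝ → Euc m) : Euc n :=
  S.transition r y u r
      ((S.gram r y u).inverse (∫ τ in (0 : ℝ)..r, S.qMat r y u τ (S.pVec r y u τ)))
    + S.theta r y u r

/-- Bounded inputs produce bounded trajectories. -/
def BoundedTrajectories (S : ControlSystem n k m) : Prop :=
  ∀ (x₀ : Euc n) (y₀ : Euc k) (u : ℝ → Euc m), MemLinf (Ici 0) S.U u →
    ∀ (x : ℝ → Euc n) (y : ℝ → Euc k), S.IsSolution (Ici 0) u x₀ y₀ x y →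
      supNormOn (Ici 0) y + supNormOn (Ici 0) x < ⊤

/-- Complete continuity of the reconstruction operator with respect to `y`: for all (supremum-)
bounded sets `B` of outputs and `V` of inputs on `[0, r]`, the image `P(B × V)` is bounded, and
`P(·, u)` is uniformly continuous on `B` in the supremum norm, uniformly in `u ∈ V`. -/
def ReconCompletelyContinuous (S : ControlSystem n k m) (r : ℝ) : Prop :=
  ∀ (B : Set (ℝ → Euc k)) (V : Set (ℝ → Euc m)),
    (∀ y ∈ B, MemLinf (Icc 0 r) univ y) → (∀ u ∈ V, MemLinf (Icc 0 r) S.U u) →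
    (∃ M : ℝ≥0, ∀ y ∈ B, supNormOn (Icc 0 r) y ≤ M) →
    (∃ M : ℝ≥0, ∀ u ∈ V, supNormOn (Icc 0 r) u ≤ M) →
      Bornology.IsBounded (image2 (S.recon r) B V) ∧
      ∀ ε : ℝ, 0 < ε → ∃ δ : ℝ, 0 < δ ∧ ∀ y ∈ B, ∀ y' ∈ B, ∀ u ∈ V,
        supNormOn (Icc 0 r) (y - y') < ENNReal.ofReal δ → ‖S.recon r y u - S.recon r y' u‖ < ε

/-- `z` is the trajectory of the reduced-order hybrid dead-beat observer fed with the measured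
output `w` and the input `u`, with sampling times `τ_i = i r`: it starts at `z₀`, solves
`z' = A(w, u) z + b(w, u)` on every `[τ_i, τ_{i+1})`, and is reset to
`z(τ_{i+1}) = P(δ_{τ_i} w, δ_{τ_i} u)`. -/
def IsObserver (S : ControlSystem n k m) (r : ℝ) (u : ℝ → Euc m) (w : ℝ → Euc k) (z₀ : Euc n)
    (z : ℝ → Euc n) : Prop :=
  z 0 = z₀ ∧
  (∀ i : ℕ, ∀ t ∈ Ico ((i : ℝ) * r) (((i : ℝ) + 1) * r),
    IntervalIntegrable (fun s => S.A (w s) (u s) (z s) + S.b (w s) (u s)) volume (i * r) t ∧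
    z t = z (i * r) + ∫ s in ((i : ℝ) * r)..t, (S.A (w s) (u s) (z s) + S.b (w s) (u s))) ∧
  ∀ i : ℕ, z (((i : ℝ) + 1) * r) = S.recon r (shift (i * r) w) (shift (i * r) u)

/-- `(x, y, z)` is a solution of the interconnection of the control system and the observer, the
latter being fed with the corrupted output `y + e`. -/
def IsCoupledSolution (S : ControlSystem n k m) (r : ℝ) (u : ℝ → Euc m) (e : ℝ → Euc k)
    (x₀ : Euc n) (y₀ : Euc k) (z₀ : Euc n) (x : ℝ → Euc n) (y : ℝ → Euc k) (z : ℝ → Euc n) :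
    Prop :=
  S.IsSolution (Ici 0) u x₀ y₀ x y ∧ S.IsObserver r u (y + e) z₀ z

end ControlSystem

end

/-! Fix the true output and set `e = 0`. Variation of constants gives `x(t) = Φ(t) x₀ + θ(t)`.
Substituting this into the integrated output equation gives `p(t) = q(t)ᵀ x₀`, and multiplying by
`q(t)` and integrating gives `∫ q p = Q x₀`. If `Q v = 0`, then `q(t)ᵀ v = 0` on `[0, r]`, so `(x +
Φ v, y)` is a second solution with the same output; strong observability forces `v = 0`. Hence `Q`
is invertible and `P(y, u) = x(r)` (`recon_eq`). By time invariance, every reset of the observer is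
exact when there is no measurement error.

With an error, (R2) controls the reset value: `P` is bounded on bounded outputs, and it is close to
the exact value when `e` is small on the preceding window. Both estimates are uniform over the
windows because the trajectory is bounded by (R1). Between resets, `z - x` solves a perturbed linear
equation, and Gronwall's inequality over a time at most `r` multiplies the initial error by a fixed
factor and adds a term that is small with `e`. Since a reset depends only on the latest window,
errors do not accumulate. This gives (a) via `exists_norm_sub_le_of_bounded`, and both (b) and (c)
via `exists_norm_sub_le_of_small`, started at different window indices.

One gap has to be bridged: (R2) speaks of inputs bounded in the true supremum norm, whereas `u` is
only essentially bounded. As `P` sees `u` only up to null sets (`recon_congr_ae`), `u` may be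
replaced by a bounded representative with values in `U`. -/

/-! ### Linear integral equations with bounded measurable coefficients -/

section LinearODE

variable {E F G : Type*} [NormedAddCommGroup E] [NormedSpace ℝ E] [NormedAddCommGroup F]
  [NormedSpace ℝ F] [NormedAddCommGroup G] [NormedSpace ℝ G]

theorem le_mul_exp_of_le_add_mul_integral {φ : ℝ → ℝ} (hφ : Continuous φ) (h0 : ∀ t, 0 ≤ φ t)
    {a b C L : ℝ} (hC : 0 ≤ C) (hL : 0 ≤ L)
    (h : ∀ t ∈ Icc a b, φ t ≤ C + L * ∫ s in a..t, φ s) :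
    ∀ t ∈ Icc a b, φ t ≤ C * Real.exp (L * (t - a)) := by
  intro t ht
  have hd : ∀ t, HasDerivAt (fun t => C + L * ∫ s in a..t, φ s) (L * φ t) t := fun t =>
    ((hφ.integral_hasStrictDerivAt a t).hasDerivAt.const_mul L).const_add C
  have key := norm_le_gronwallBound_of_norm_deriv_right_le (K := L) (ε := 0) (δ := C) (a := a)
    (b := b) (f := fun t => C + L * ∫ s in a..t, φ s) (f' := fun t => L * φ t)
    (fun t _ => (hd t).continuousAt.continuousWithinAt) (fun t _ => (hd t).hasDerivWithinAt)
    (by simp [abs_of_nonneg hC]) (by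
      intro s hs
      have := h s ⟨hs.1, hs.2.le⟩
      rw [norm_mul, Real.norm_of_nonneg hL, Real.norm_of_nonneg (h0 s), add_zero]
      exact mul_le_mul_of_nonneg_left (this.trans (le_abs_self _)) hL) t ht
  rw [gronwallBound_ε0] at key
  exact (h t ht).trans ((le_abs_self _).trans key)

theorem continuousOn_of_eq_add_integral {g z : ℝ → E} {a b : ℝ}
    (hg : IntervalIntegrable g volume a b)
    (hz : ∀ t ∈ Icc a b, z t = z a + ∫ s in a..t, g s) : ContinuousOn z (Icc a b) := by
  rcases le_or_gt a b with hab | hab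
  · have := intervalIntegral.continuousOn_primitive_interval' hg left_mem_uIcc
    rw [uIcc_of_le hab] at this
    exact (continuousOn_const.add this).congr hz
  · simp [Icc_eq_empty hab.not_ge]

theorem norm_le_of_eq_add_integral {g z : ℝ → E} {a b L η : ℝ} (hL : 0 ≤ L) (hη : 0 ≤ η)
    (hab : a ≤ b) (hg : IntervalIntegrable g volume a b)
    (hz : ∀ t ∈ Icc a b, z t = z a + ∫ s in a..t, g s)
    (hgz : ∀ᵐ s ∂volume.restrict (Icc a b), ‖g s‖ ≤ L * ‖z s‖ + η) :
    ‖z b‖ ≤ (‖z a‖ + η * (b - a)) * Real.exp (L * (b - a)) := by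
  have hc := continuousOn_of_eq_add_integral hg hz
  -- Extending `‖z‖` by its end values gives a function continuous on all of `ℝ`, as the scalar
  -- Gronwall lemma requires.
  set φ : ℝ → ℝ := IccExtend hab ((Icc a b).domRestrict fun t => ‖z t‖) with hφ
  have hφc : Continuous φ := (continuousOn_iff_continuous_domRestrict.1 hc.norm).Icc_extend'
  have hφe : ∀ t ∈ Icc a b, φ t = ‖z t‖ := fun t ht => by
    rw [hφ, IccExtend_of_mem _ _ ht]; rfl
  rw [← hφe b ⟨hab, le_rfl⟩]
  refine le_mul_exp_of_le_add_mul_integral hφc (fun t => norm_nonneg _)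
    (by have := sub_nonneg.2 hab; positivity) hL ?_ b ⟨hab, le_rfl⟩
  intro t ht
  rw [hφe t ht, hz t ht]
  have hgt : IntervalIntegrable g volume a t := hg.mono_set (by
    rw [uIcc_of_le ht.1, uIcc_of_le hab]; exact Icc_subset_Icc_right ht.2)
  have h1 : ‖∫ s in a..t, g s‖ ≤ ∫ s in a..t, (L * φ s + η) := by
    refine intervalIntegral.norm_integral_le_of_norm_le ht.1 ?_
      ((hφc.const_mul L |>.add continuous_const).intervalIntegrable _ _)
    filter_upwards [(ae_restrict_iff' measurableSet_Icc).1 hgz] with s hs hst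
    have : s ∈ Icc a b := ⟨hst.1.le, hst.2.trans ht.2⟩
    rw [hφe s this]
    exact hs this
  rw [intervalIntegral.integral_add ((hφc.const_mul L).intervalIntegrable _ _) (by simp),
    intervalIntegral.integral_const_mul, intervalIntegral.integral_const, smul_eq_mul] at h1
  have h2 : (t - a) * η ≤ η * (b - a) := by nlinarith [ht.2]
  linarith [norm_add_le (z a) (∫ s in a..t, g s)]

/-- Backward uniqueness: the reflection `s ↦ a + b - s` exchanges the two ends, and the Gronwall
bound then starts from the value zero. -/
theorem eq_zero_left_of_eq_add_integral {g z : ℝ → E} {a b L : ℝ} (hL : 0 ≤ L) (hab : a ≤ b)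
    (hg : IntervalIntegrable g volume a b)
    (hz : ∀ t ∈ Icc a b, z t = z a + ∫ s in a..t, g s)
    (hgz : ∀ᵐ s ∂volume.restrict (Icc a b), ‖g s‖ ≤ L * ‖z s‖) (hb : z b = 0) : z a = 0 := by
  have hgi : IntervalIntegrable (fun s => -g (a + b - s)) volume a b := by
    have := (hg.comp_sub_left (a + b)).symm
    rw [add_sub_cancel_left, add_sub_cancel_right] at this
    exact this.neg
  have := norm_le_of_eq_add_integral (z := fun t => z (a + b - t)) (g := fun s => -g (a + b - s))
    (η := 0) hL le_rfl hab hgi ?_ ?_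
  · simpa [hb] using this
  · intro t ht
    have ht' : a + b - t ∈ Icc a b := ⟨by linarith [ht.2], by linarith [ht.1]⟩
    have hsub : ∀ c ∈ Icc a b, IntervalIntegrable g volume a c := fun c hc => hg.mono_set (by
      rw [uIcc_of_le hc.1, uIcc_of_le hab]; exact Icc_subset_Icc_right hc.2)
    simp only [intervalIntegral.integral_neg, intervalIntegral.integral_comp_sub_left]
    rw [add_sub_cancel_left, hz _ ht', hz b ⟨hab, le_rfl⟩,
      ← intervalIntegral.integral_add_adjacent_intervals (hsub _ ht')
        ((hsub _ ht').symm.trans hg)]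
    abel
  · have hmp : MeasurePreserving (fun s : ℝ => a + b - s) (volume.restrict (Icc a b))
        (volume.restrict (Icc a b)) := by
      have := (Measure.measurePreserving_sub_left volume (a + b)).restrict_preimage
        (s := Icc a b) measurableSet_Icc
      simpa using this
    filter_upwards [hmp.quasiMeasurePreserving.ae hgz] with s hs
    simpa using hs

omit [NormedSpace ℝ E] in
theorem MeasureTheory.MemLp.intervalIntegrable_of_top {f : ℝ → E} {a b : ℝ} (hab : a ≤ b)
    (hf : MemLp f ∞ (volume.restrict (Icc a b))) : IntervalIntegrable f volume a b := by
  rw [intervalIntegrable_iff_integrableOn_Icc_of_le hab]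
  exact hf.integrable le_top

omit [NormedSpace ℝ E] in
theorem MeasureTheory.MemLp.exists_ae_norm_le {α : Type*} [MeasurableSpace α] {μ : Measure α}
    {f : α → E} (hf : MemLp f ∞ μ) : ∃ C : ℝ, 0 ≤ C ∧ ∀ᵐ s ∂μ, ‖f s‖ ≤ C := by
  refine ⟨(eLpNorm f ∞ μ).toReal, ENNReal.toReal_nonneg, ?_⟩
  have h := hf.2
  rw [eLpNorm_exponent_top] at h ⊢
  filter_upwards [ae_le_eLpNormEssSup (f := f) (μ := μ)] with s hs
  rw [← toReal_enorm]
  exact ENNReal.toReal_mono h.ne hs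

omit [NormedSpace ℝ E] in
theorem ContinuousOn.memLp_top {f : ℝ → E} {a b : ℝ} (hf : ContinuousOn f (Icc a b)) :
    MemLp f ∞ (volume.restrict (Icc a b)) := by
  obtain ⟨C, hC⟩ := isCompact_Icc.exists_bound_of_continuousOn hf
  exact MemLp.of_bound (hf.aestronglyMeasurable_of_isCompact isCompact_Icc measurableSet_Icc) C
    ((ae_restrict_iff' measurableSet_Icc).2 (.of_forall hC))

theorem MeasureTheory.MemLp.bilin_top {α : Type*} [MeasurableSpace α] {μ : Measure α}
    (B : E →L[ℝ] F →L[ℝ] G) {f : α → E} {g : α → F} (hf : MemLp f ∞ μ) (hg : MemLp g ∞ μ) :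
    MemLp (fun s => B (f s) (g s)) ∞ μ := by
  obtain ⟨C, hC0, hC⟩ := hf.exists_ae_norm_le
  obtain ⟨D, hD0, hD⟩ := hg.exists_ae_norm_le
  refine memLp_top_of_bound (B.aestronglyMeasurable_comp₂ hf.1 hg.1) (‖B‖ * C * D) ?_
  filter_upwards [hC, hD] with s h1 h2
  refine (B.le_opNorm₂ _ _).trans ?_
  gcongr

theorem MeasureTheory.MemLp.clm_apply_top {α : Type*} [MeasurableSpace α] {μ : Measure α}
    {f : α → E →L[ℝ] F} {g : α → E} (hf : MemLp f ∞ μ) (hg : MemLp g ∞ μ) :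
    MemLp (fun s => f s (g s)) ∞ μ :=
  hf.bilin_top (ContinuousLinearMap.id ℝ (E →L[ℝ] F)) hg

theorem MeasureTheory.MemLp.clm_comp_top {α : Type*} [MeasurableSpace α] {μ : Measure α}
    {f : α → F →L[ℝ] G} {g : α → E →L[ℝ] F} (hf : MemLp f ∞ μ) (hg : MemLp g ∞ μ) :
    MemLp (fun s => f s ∘L g s) ∞ μ :=
  hf.bilin_top (ContinuousLinearMap.compL ℝ E F G) hg

theorem norm_integral_sub_integral_le {f : ℝ → E} {a b C : ℝ}
    (hf : IntervalIntegrable f volume a b) (hC : ∀ᵐ s ∂volume.restrict (Icc a b), ‖f s‖ ≤ C)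
    {s t : ℝ} (hs : s ∈ Icc a b) (ht : t ∈ Icc a b) :
    ‖(∫ x in a..s, f x) - ∫ x in a..t, f x‖ ≤ C * |s - t| := by
  have hab := hs.1.trans hs.2
  have hsub : ∀ c ∈ Icc a b, IntervalIntegrable f volume a c := fun c hc => hf.mono_set (by
      rw [uIcc_of_le hc.1, uIcc_of_le hab]; exact Icc_subset_Icc_right hc.2)
  rw [intervalIntegral.integral_interval_sub_left (hsub s hs) (hsub t ht)]
  refine intervalIntegral.norm_integral_le_of_norm_le_const_ae ?_
  filter_upwards [(ae_restrict_iff' measurableSet_Icc).1 hC] with x hx hxt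
  have := uIoc_subset_uIcc hxt
  exact hx (uIcc_subset_Icc ht hs this)

/-- Product rule for primitives of bounded functions. The difference of the two sides, as a function
of the upper limit, is Lipschitz, hence absolutely continuous, and its derivative vanishes almost
everywhere; so it is constant. -/
theorem bilin_integral_integral [CompleteSpace E] [CompleteSpace F] [CompleteSpace G]
    (B : E →L[ℝ] F →L[ℝ] G) {f : ℝ → E} {g : ℝ → F} {a b : ℝ} {f₀ : E} {g₀ : F} (hab : a ≤ b)
    (hf : MemLp f ∞ (volume.restrict (Icc a b))) (hg : MemLp g ∞ (volume.restrict (Icc a b))) :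
    B (f₀ + ∫ s in a..b, f s) (g₀ + ∫ s in a..b, g s) = B f₀ g₀ + ∫ s in a..b,
      (B (f s) (g₀ + ∫ x in a..s, g x) + B (f₀ + ∫ x in a..s, f x) (g s)) := by
  have hfi := hf.intervalIntegrable_of_top hab
  have hgi := hg.intervalIntegrable_of_top hab
  obtain ⟨C, hC0, hC⟩ := hf.exists_ae_norm_le
  obtain ⟨D, hD0, hD⟩ := hg.exists_ae_norm_le
  set P : ℝ → E := fun t => f₀ + ∫ s in a..t, f s with hP
  set R : ℝ → F := fun t => g₀ + ∫ s in a..t, g s with hR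
  have hPc : ContinuousOn P (Icc a b) :=
    continuousOn_of_eq_add_integral hfi (fun t _ => by simp [hP])
  have hRc : ContinuousOn R (Icc a b) :=
    continuousOn_of_eq_add_integral hgi (fun t _ => by simp [hR])
  have hh : MemLp (fun s => B (f s) (R s) + B (P s) (g s)) ∞ (volume.restrict (Icc a b)) :=
    (hf.bilin_top B hRc.memLp_top).add (hPc.memLp_top.bilin_top B hg)
  obtain ⟨H, hH0, hH⟩ := hh.exists_ae_norm_le
  have hhi := hh.intervalIntegrable_of_top hab
  set h : ℝ → G := fun s => B (f s) (R s) + B (P s) (g s) with hhdef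
  obtain ⟨CP, hCP⟩ := isCompact_Icc.exists_bound_of_continuousOn hPc
  obtain ⟨CR, hCR⟩ := isCompact_Icc.exists_bound_of_continuousOn hRc
  have hCP0 : 0 ≤ CP := (norm_nonneg _).trans (hCP a ⟨le_rfl, hab⟩)
  have hCR0 : 0 ≤ CR := (norm_nonneg _).trans (hCR a ⟨le_rfl, hab⟩)
  have hLip : LipschitzOnWith (Real.toNNReal (‖B‖ * C * CR + ‖B‖ * CP * D + H))
      (fun t => B (P t) (R t) - ∫ s in a..t, h s) (uIcc a b) := by
    rw [uIcc_of_le hab]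
    refine LipschitzOnWith.of_dist_le_mul fun s hs t ht => ?_
    rw [Real.coe_toNNReal _ (by positivity), dist_eq_norm, Real.dist_eq]
    have e1 : ‖P s - P t‖ ≤ C * |s - t| := by
      simpa [hP] using norm_integral_sub_integral_le hfi hC hs ht
    have e2 : ‖R s - R t‖ ≤ D * |s - t| := by
      simpa [hR] using norm_integral_sub_integral_le hgi hD hs ht
    have e3 := norm_integral_sub_integral_le hhi hH hs ht
    have e : B (P s) (R s) - (∫ x in a..s, h x) - (B (P t) (R t) - ∫ x in a..t, h x)
        = B (P s - P t) (R s) + B (P t) (R s - R t)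
          - ((∫ x in a..s, h x) - ∫ x in a..t, h x) := by
      simp only [map_sub, sub_apply]; abel
    rw [e]
    calc _ ≤ ‖B‖ * ‖P s - P t‖ * ‖R s‖ + ‖B‖ * ‖P t‖ * ‖R s - R t‖
          + ‖(∫ x in a..s, h x) - ∫ x in a..t, h x‖ :=
          (norm_sub_le _ _).trans (add_le_add_left ((norm_add_le _ _).trans
            (add_le_add (B.le_opNorm₂ _ _) (B.le_opNorm₂ _ _))) _)
      _ ≤ ‖B‖ * (C * |s - t|) * CR + ‖B‖ * CP * (D * |s - t|) + H * |s - t| := by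
          gcongr
          · exact hCR s hs
          · exact hCP t ht
      _ = _ := by ring
  obtain ⟨c, hc⟩ := hLip.absolutelyContinuousOnInterval.const_of_ae_hasDerivAt_zero (by
    filter_upwards [hfi.ae_hasDerivAt_integral, hgi.ae_hasDerivAt_integral,
      hhi.ae_hasDerivAt_integral] with t h1 h2 h3 ht
    have d1 : HasDerivAt P (f t) t := (h1 ht a left_mem_uIcc).const_add f₀
    have d2 : HasDerivAt R (g t) t := (h2 ht a left_mem_uIcc).const_add g₀
    have d3 := h3 ht a left_mem_uIcc
    have := (B.hasDerivAt_of_bilinear (fun _ => d1) (fun _ => d2)).sub d3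
    convert! this using 1
    simp only [hhdef]; abel)
  have ca := hc a left_mem_uIcc
  have cb := hc b right_mem_uIcc
  simp only [intervalIntegral.integral_same, sub_zero] at ca
  have hPa : P a = f₀ := by simp [hP]
  have hRa : R a = g₀ := by simp [hR]
  rw [hPa, hRa] at ca
  rw [ca, ← cb]; abel

/-- Picard iteration on the whole interval at once: coefficients are merely measurable, but the
`j`-th iterate of the integral operator has Lipschitz constant `(L (b - a)) ^ j / j!`, which is
eventually below `1 / 2`. -/
theorem exists_eq_add_integral_linear [CompleteSpace E] {α : ℝ → E →L[ℝ] E} {β : ℝ → E}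
    {a b : ℝ} (hab : a ≤ b) (hα : MemLp α ∞ (volume.restrict (Icc a b)))
    (hβ : MemLp β ∞ (volume.restrict (Icc a b))) (z₀ : E) :
    ∃ z : ℝ → E, ContinuousOn z (Icc a b) ∧
      ∀ t ∈ Icc a b, z t = z₀ + ∫ s in a..t, (α s (z s) + β s) := by
  obtain ⟨L, hL0, hL⟩ := hα.exists_ae_norm_le
  have hmem : ∀ f : C(Icc a b, E),
      MemLp (fun s => α s (IccExtend hab f s)) ∞ (volume.restrict (Icc a b)) := fun f =>
    hα.clm_apply_top (f.continuous.Icc_extend' (h := hab)).continuousOn.memLp_top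
  have hint : ∀ f : C(Icc a b, E), IntervalIntegrable
      (fun s => α s (IccExtend hab f s) + β s) volume a b := fun f =>
    ((hmem f).add hβ).intervalIntegrable_of_top hab
  let N : C(Icc a b, E) → C(Icc a b, E) := fun f =>
    ⟨(Icc a b).domRestrict fun t => z₀ + ∫ s in a..t, (α s (IccExtend hab f s) + β s),
      continuousOn_iff_continuous_domRestrict.1
        (continuousOn_of_eq_add_integral (hint f) (fun t _ => by simp))⟩
  have hN : ∀ f (t : Icc a b), N f t = z₀ + ∫ s in a..t, (α s (IccExtend hab f s) + β s) :=
    fun f t => rfl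
  have key : ∀ (f g : C(Icc a b, E)) (j : ℕ) (t : Icc a b),
      ‖(N^[j] f) t - (N^[j] g) t‖ ≤ (L * (t - a)) ^ j / j.factorial * dist f g := by
    intro f g j
    induction j with
    | zero => intro t; simpa [dist_eq_norm] using ContinuousMap.norm_coe_le_norm (f - g) t
    | succ j ih =>
      intro t
      have hsub : ∀ h : C(Icc a b, E), IntervalIntegrable
          (fun s => α s (IccExtend hab h s) + β s) volume a t := fun h => (hint h).mono_set (by
        rw [uIcc_of_le t.2.1, uIcc_of_le hab]; exact Icc_subset_Icc_right t.2.2)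
      rw [Function.iterate_succ_apply', Function.iterate_succ_apply', hN, hN,
        add_sub_add_left_eq_sub, ← intervalIntegral.integral_sub (hsub _) (hsub _)]
      have hle : ‖∫ s in a..(t : ℝ), ((α s (IccExtend hab (N^[j] f) s) + β s)
          - (α s (IccExtend hab (N^[j] g) s) + β s))‖
          ≤ ∫ s in a..(t : ℝ), L ^ (j + 1) / j.factorial * dist f g * (s - a) ^ j := by
        refine intervalIntegral.norm_integral_le_of_norm_le t.2.1 ?_
          (Continuous.intervalIntegrable (by fun_prop) _ _)
        filter_upwards [(ae_restrict_iff' measurableSet_Icc).1 hL] with s hs hst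
        have hs' : s ∈ Icc a b := ⟨hst.1.le, hst.2.trans t.2.2⟩
        rw [add_sub_add_right_eq_sub, ← map_sub, IccExtend_of_mem _ _ hs', IccExtend_of_mem _ _ hs']
        calc _ ≤ L * ((L * (s - a)) ^ j / j.factorial * dist f g) :=
              (α s).le_of_opNorm_le_of_le (hs hs') (ih ⟨s, hs'⟩)
          _ = _ := by rw [mul_pow]; ring
      refine hle.trans_eq ?_
      rw [intervalIntegral.integral_const_mul,
        intervalIntegral.integral_comp_sub_right (fun s => s ^ j), integral_pow]
      have : (j.factorial : ℝ) ≠ 0 := by positivity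
      have : (j + 1 : ℝ) ≠ 0 := by positivity
      rw [Nat.factorial_succ, mul_pow]
      push_cast
      field_simp
      simp
  obtain ⟨j, hj⟩ : ∃ j : ℕ, (L * (b - a)) ^ j / j.factorial < 1 / 2 :=
    ((FloorSemiring.tendsto_pow_div_factorial_atTop (L * (b - a))).eventually
      (gt_mem_nhds (by norm_num))).exists
  have hcontr : ContractingWith (1 / 2) N^[j] := by
    refine ⟨by rw [← NNReal.coe_lt_coe]; norm_num, LipschitzWith.of_dist_le_mul fun f g => ?_⟩
    refine (ContinuousMap.dist_le (by positivity)).2 fun t => ?_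
    rw [dist_eq_norm]
    refine (key f g j t).trans ?_
    have h0 : 0 ≤ L * ((t : ℝ) - a) := mul_nonneg hL0 (sub_nonneg.2 t.2.1)
    have h1 : L * ((t : ℝ) - a) ≤ L * (b - a) := by
      gcongr; exact t.2.2
    have : (L * ((t : ℝ) - a)) ^ j / j.factorial ≤ 1 / 2 :=
      le_trans (by gcongr) hj.le
    push_cast
    gcongr
  -- `N` commutes with its iterate, so it maps the unique fixed point of `N^[j]` to itself.
  have hfix : N (hcontr.fixedPoint N^[j]) = hcontr.fixedPoint N^[j] :=
    hcontr.isFixedPt_fixedPoint_iterate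
  set f := hcontr.fixedPoint N^[j]
  refine ⟨IccExtend hab f, (f.continuous.Icc_extend' (h := hab)).continuousOn, fun t ht => ?_⟩
  rw [← hN f ⟨t, ht⟩, hfix, IccExtend_of_mem]

end LinearODE

/-! ### Bounded measurable coefficients along trajectories -/

theorem MeasureTheory.MemLp.restrict_Icc_mono {E : Type*} [NormedAddCommGroup E] {f : ℝ → E}
    {p : ℝ≥0∞} {a b c d : ℝ} (hf : MemLp f p (volume.restrict (Icc a b))) (hac : a ≤ c)
    (hdb : d ≤ b) : MemLp f p (volume.restrict (Icc c d)) :=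
  hf.mono_measure (Measure.restrict_mono (Icc_subset_Icc hac hdb) le_rfl)

/-- `F` is controlled only on `univ ×ˢ U`. The joint law of `(y, u)` is carried by this closed set,
which gives measurability; essential boundedness of `(y, u)` confines it to a compact part of that
set, which gives the bound. -/
theorem memLp_top_comp_of_continuousOn {X₁ X₂ Y α : Type*} [NormedAddCommGroup X₁]
    [NormedSpace ℝ X₁] [FiniteDimensional ℝ X₁] [NormedAddCommGroup X₂] [NormedSpace ℝ X₂]
    [FiniteDimensional ℝ X₂] [NormedAddCommGroup Y] {U : Set X₂} (hU : IsClosed U)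
    {F : X₁ → X₂ → Y} (hF : ContinuousOn (fun p : X₁ × X₂ => F p.1 p.2) (univ ×ˢ U))
    [MeasurableSpace α] {μ : Measure α} {y : α → X₁} {u : α → X₂} (hy : MemLp y ∞ μ)
    (hu : MemLp u ∞ μ) (huU : ∀ᵐ s ∂μ, u s ∈ U) : MemLp (fun s => F (y s) (u s)) ∞ μ := by
  have : ProperSpace X₁ := FiniteDimensional.proper_real X₁
  have : ProperSpace X₂ := FiniteDimensional.proper_real X₂
  borelize (X₁ × X₂)
  obtain ⟨C, -, hC⟩ := hy.exists_ae_norm_le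
  obtain ⟨D, -, hD⟩ := hu.exists_ae_norm_le
  have hcl : IsClosed ((univ : Set X₁) ×ˢ U) := isClosed_univ.prod hU
  have hpm : AEStronglyMeasurable (fun s => (y s, u s)) μ := hy.1.prodMk hu.1
  have hmem : ∀ᵐ p ∂μ.map (fun s => (y s, u s)), p ∈ (univ : Set X₁) ×ˢ U :=
    (ae_map_iff hpm.aemeasurable hcl.measurableSet).2 (by
      filter_upwards [huU] with s hs using ⟨mem_univ _, hs⟩)
  have hFm : AEStronglyMeasurable (fun p : X₁ × X₂ => F p.1 p.2)
      (μ.map (fun s => (y s, u s))) := by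
    rw [← Measure.restrict_eq_self_of_ae_mem hmem]
    exact hF.aestronglyMeasurable hcl.measurableSet
  have hK : IsCompact (Metric.closedBall (0 : X₁) C ×ˢ (Metric.closedBall (0 : X₂) D ∩ U)) :=
    (isCompact_closedBall _ _).prod ((isCompact_closedBall _ _).inter_right hU)
  obtain ⟨M, hM⟩ := hK.exists_bound_of_continuousOn
    (hF.mono (prod_mono (subset_univ _) inter_subset_right))
  refine memLp_top_of_bound (hFm.comp_aemeasurable hpm.aemeasurable) M ?_
  filter_upwards [hC, hD, huU] with s h1 h2 h3
  exact hM (y s, u s) ⟨by simpa using h1, by simpa using h2, h3⟩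

/-! ### Fundamental solutions and variation of constants -/

section Fundamental

variable {V : Type*} [NormedAddCommGroup V] [NormedSpace ℝ V]

/-- `Φ` is the fundamental solution of `x' = α(t) x` on `[0, r]`. -/
def IsFundamental (α : ℝ → V →L[ℝ] V) (r : ℝ) (Φ : ℝ → V →L[ℝ] V) : Prop :=
  ∀ t ∈ Icc 0 r, IntervalIntegrable (fun s => α s ∘L Φ s) volume 0 t ∧
    Φ t = ContinuousLinearMap.id ℝ V + ∫ s in (0 : ℝ)..t, α s ∘L Φ s

variable {α Φ : ℝ → V →L[ℝ] V} {r : ℝ} {β : ℝ → V}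

theorem exists_isFundamental [CompleteSpace V] (hr : 0 ≤ r)
    (hα : MemLp α ∞ (volume.restrict (Icc 0 r))) : ∃ Φ, IsFundamental α r Φ := by
  -- The matrix equation is a linear equation on the space of operators, with left multiplication by
  -- `α s` as its coefficient.
  have hα' : MemLp (fun s => ContinuousLinearMap.compL ℝ V V V (α s)) ∞
      (volume.restrict (Icc 0 r)) :=
    (ContinuousLinearMap.compL ℝ V V V).comp_memLp' hα
  obtain ⟨Φ, hΦc, hΦ⟩ := exists_eq_add_integral_linear (β := 0) hr hα' MemLp.zero
    (ContinuousLinearMap.id ℝ V)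
  refine ⟨Φ, fun t ht => ⟨?_, by simpa using hΦ t ht⟩⟩
  exact ((hα.clm_comp_top hΦc.memLp_top).restrict_Icc_mono le_rfl ht.2).intervalIntegrable_of_top
    ht.1

namespace IsFundamental

theorem apply_zero (hΦ : IsFundamental α r Φ) (hr : 0 ≤ r) : Φ 0 = ContinuousLinearMap.id ℝ V := by
  simpa using (hΦ 0 ⟨le_rfl, hr⟩).2

theorem continuousOn (hΦ : IsFundamental α r Φ) : ContinuousOn Φ (Icc 0 r) := by
  rcases le_or_gt 0 r with hr | hr
  · refine continuousOn_of_eq_add_integral (hΦ r ⟨hr, le_rfl⟩).1 fun t ht => ?_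
    rw [hΦ.apply_zero hr]
    exact (hΦ t ht).2
  · simp [Icc_eq_empty hr.not_ge]

theorem apply_eq [CompleteSpace V] (hΦ : IsFundamental α r Φ) (v : V) {t : ℝ} (ht : t ∈ Icc 0 r) :
    IntervalIntegrable (fun s => α s (Φ s v)) volume 0 t ∧
      Φ t v = v + ∫ s in (0 : ℝ)..t, α s (Φ s v) := by
  have h := hΦ t ht
  refine ⟨⟨(ContinuousLinearMap.apply ℝ V v).integrable_comp h.1.1,
    (ContinuousLinearMap.apply ℝ V v).integrable_comp h.1.2⟩, ?_⟩
  conv_lhs => rw [h.2]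
  rw [add_apply, ContinuousLinearMap.intervalIntegral_apply h.1]
  rfl

/-- If `Φ t v = 0`, backward uniqueness for `s ↦ Φ s v` gives `v = 0`; finite dimension does the
rest. -/
theorem isInvertible [FiniteDimensional ℝ V] (hΦ : IsFundamental α r Φ)
    (hα : MemLp α ∞ (volume.restrict (Icc 0 r))) {t : ℝ} (ht : t ∈ Icc 0 r) :
    (Φ t).IsInvertible := by
  have : CompleteSpace V := FiniteDimensional.complete ℝ V
  obtain ⟨L, hL0, hL⟩ := (hα.restrict_Icc_mono le_rfl ht.2).exists_ae_norm_le
  have h0 := hΦ.apply_zero (ht.1.trans ht.2)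
  have hinj : Function.Injective (Φ t) := by
    refine (injective_iff_map_eq_zero _).2 fun v hv => ?_
    have := eq_zero_left_of_eq_add_integral (z := fun s => Φ s v) hL0 ht.1
      (hΦ.apply_eq v ht).1 (fun s hs => ?_) ?_ hv
    · simpa [h0] using this
    · simp only [h0]
      exact (hΦ.apply_eq v ⟨hs.1, hs.2.trans ht.2⟩).2
    · filter_upwards [hL] with s hs using (α s).le_of_opNorm_le hs _
  exact ⟨(LinearEquiv.ofInjectiveEndo (Φ t : V →ₗ[ℝ] V) hinj).toContinuousLinearEquiv, by
    ext v; rfl⟩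

theorem continuousOn_inverse [FiniteDimensional ℝ V] (hΦ : IsFundamental α r Φ)
    (hα : MemLp α ∞ (volume.restrict (Icc 0 r))) :
    ContinuousOn (fun s => (Φ s).inverse) (Icc 0 r) := by
  have : CompleteSpace V := FiniteDimensional.complete ℝ V
  intro t ht
  obtain ⟨e, he⟩ := hΦ.isInvertible hα ht
  have : ContinuousAt (ContinuousLinearMap.inverse : (V →L[ℝ] V) → _) (Φ t) :=
    he ▸ (contDiffAt_map_inverse (n := 0) e).continuousAt
  exact this.comp_continuousWithinAt (hΦ.continuousOn t ht)

/-- Write `θ` as `Φ` applied to the primitive of `Φ⁻¹ β` and use the product rule for the evaluation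
pairing; `Φ Φ⁻¹ = 1` leaves `β`. -/
theorem variation_of_constants_eq [FiniteDimensional ℝ V] (hΦ : IsFundamental α r Φ)
    (hα : MemLp α ∞ (volume.restrict (Icc 0 r))) (hβ : MemLp β ∞ (volume.restrict (Icc 0 r)))
    {θ : ℝ → V} (hθ : ∀ t, θ t = ∫ s in (0 : ℝ)..t, Φ t ((Φ s).inverse (β s)))
    {t : ℝ} (ht : t ∈ Icc 0 r) : θ t = ∫ s in (0 : ℝ)..t, (α s (θ s) + β s) := by
  have : CompleteSpace V := FiniteDimensional.complete ℝ V
  have hg : MemLp (fun s => (Φ s).inverse (β s)) ∞ (volume.restrict (Icc 0 r)) :=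
    (hΦ.continuousOn_inverse hα).memLp_top.clm_apply_top hβ
  have hf : MemLp (fun s => α s ∘L Φ s) ∞ (volume.restrict (Icc 0 r)) :=
    hα.clm_comp_top hΦ.continuousOn.memLp_top
  have hθ' : ∀ τ ∈ Icc 0 r, θ τ = Φ τ (∫ s in (0 : ℝ)..τ, (Φ s).inverse (β s)) := fun τ hτ => by
    rw [hθ, ContinuousLinearMap.intervalIntegral_comp_comm]
    exact (hg.restrict_Icc_mono le_rfl hτ.2).intervalIntegrable_of_top hτ.1
  have key := bilin_integral_integral (ContinuousLinearMap.id ℝ (V →L[ℝ] V))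
    (f₀ := ContinuousLinearMap.id ℝ V) (g₀ := 0) ht.1 (hf.restrict_Icc_mono le_rfl ht.2)
    (hg.restrict_Icc_mono le_rfl ht.2)
  simp only [zero_add, ContinuousLinearMap.id_apply, ← (hΦ t ht).2, ← hθ' t ht] at key
  rw [key]
  refine intervalIntegral.integral_congr fun s hs => ?_
  rw [uIcc_of_le ht.1] at hs
  have hs' : s ∈ Icc 0 r := ⟨hs.1, hs.2.trans ht.2⟩
  simp only [← (hΦ s hs').2, ContinuousLinearMap.comp_apply, hθ' s hs',
    (hΦ.isInvertible hα hs').self_apply_inverse]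

/-- The difference of the two sides solves the homogeneous equation and vanishes at `0`, so Gronwall
makes it zero. -/
theorem eq_apply_add [FiniteDimensional ℝ V] (hΦ : IsFundamental α r Φ)
    (hα : MemLp α ∞ (volume.restrict (Icc 0 r))) (hβ : MemLp β ∞ (volume.restrict (Icc 0 r)))
    {θ x : ℝ → V} {x₀ : V} (hθc : ContinuousOn θ (Icc 0 r))
    (hθ : ∀ t ∈ Icc 0 r, θ t = ∫ s in (0 : ℝ)..t, (α s (θ s) + β s))
    (hxc : ContinuousOn x (Icc 0 r))
    (hx : ∀ t ∈ Icc 0 r, x t = x₀ + ∫ s in (0 : ℝ)..t, (α s (x s) + β s))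
    {t : ℝ} (ht : t ∈ Icc 0 r) : x t = Φ t x₀ + θ t := by
  have : CompleteSpace V := FiniteDimensional.complete ℝ V
  obtain ⟨L, hL0, hL⟩ := (hα.restrict_Icc_mono le_rfl ht.2).exists_ae_norm_le
  have hr : 0 ≤ r := ht.1.trans ht.2
  have h0 : x 0 - Φ 0 x₀ - θ 0 = 0 := by
    rw [hx 0 ⟨le_rfl, hr⟩, hθ 0 ⟨le_rfl, hr⟩, hΦ.apply_zero hr]; simp
  have hi : ∀ {ψ : ℝ → V}, ContinuousOn ψ (Icc 0 r) → ∀ s ∈ Icc 0 r,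
      IntervalIntegrable (fun s => α s (ψ s) + β s) volume 0 s := fun hψ s hs =>
    (((hα.clm_apply_top hψ.memLp_top).add hβ).restrict_Icc_mono le_rfl hs.2
      ).intervalIntegrable_of_top hs.1
  have key := norm_le_of_eq_add_integral (z := fun s => x s - Φ s x₀ - θ s)
    (g := fun s => (α s (x s) + β s) - α s (Φ s x₀) - (α s (θ s) + β s)) hL0 le_rfl ht.1
    (((hi hxc t ht).sub (hΦ.apply_eq x₀ ht).1).sub (hi hθc t ht)) (fun s hs => ?_) ?_
  · rw [h0] at key
    have : x t - Φ t x₀ - θ t = 0 := by simpa using key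
    rw [← sub_eq_zero, ← this]; abel
  · have hs' : s ∈ Icc 0 r := ⟨hs.1, hs.2.trans ht.2⟩
    rw [h0, intervalIntegral.integral_sub ((hi hxc s hs').sub (hΦ.apply_eq x₀ hs').1)
      (hi hθc s hs'), intervalIntegral.integral_sub (hi hxc s hs') (hΦ.apply_eq x₀ hs').1,
      hx s hs', (hΦ.apply_eq x₀ hs').2, hθ s hs']
    abel
  · filter_upwards [hL] with s hs
    rw [add_zero]
    refine le_trans (le_of_eq ?_) ((α s).le_of_opNorm_le hs (x s - Φ s x₀ - θ s))
    congr 1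
    simp only [map_sub]; abel

end IsFundamental

end Fundamental

/-! ### The reconstruction operator: exactness on true outputs, insensitivity to null sets -/

namespace ControlSystem

variable {n k m : ℕ} {S : ControlSystem n k m} {r : ℝ} {u : ℝ → Euc m} {y : ℝ → Euc k}

theorem memLp_A {J : Set ℝ} (hJ : MeasurableSet J) (hu : MemLinf J S.U u)
    (hy : MemLp y ∞ (volume.restrict J)) :
    MemLp (fun s => S.A (y s) (u s)) ∞ (volume.restrict J) :=
  memLp_top_comp_of_continuousOn S.U_closed S.A_lip.continuousOn hy hu.1
    ((ae_restrict_iff' hJ).2 (.of_forall hu.2))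

theorem memLp_b {J : Set ℝ} (hJ : MeasurableSet J) (hu : MemLinf J S.U u)
    (hy : MemLp y ∞ (volume.restrict J)) :
    MemLp (fun s => S.b (y s) (u s)) ∞ (volume.restrict J) :=
  memLp_top_comp_of_continuousOn S.U_closed S.b_lip.continuousOn hy hu.1
    ((ae_restrict_iff' hJ).2 (.of_forall hu.2))

theorem memLp_f {J : Set ℝ} (hJ : MeasurableSet J) (hu : MemLinf J S.U u)
    (hy : MemLp y ∞ (volume.restrict J)) :
    MemLp (fun s => S.f (y s) (u s)) ∞ (volume.restrict J) :=
  memLp_top_comp_of_continuousOn S.U_closed S.f_lip.continuousOn hy hu.1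
    ((ae_restrict_iff' hJ).2 (.of_forall hu.2))

/-- `IsTransition` unfolds to `IsFundamental`, and since a solution exists, the choice made by
`Classical.epsilon` is one. -/
theorem isFundamental_transition (hr : 0 ≤ r) (hu : MemLinf (Icc 0 r) S.U u)
    (hy : MemLp y ∞ (volume.restrict (Icc 0 r))) :
    IsFundamental (fun s => S.A (y s) (u s)) r (S.transition r y u) :=
  Classical.epsilon_spec (p := S.IsTransition r y u)
    (exists_isFundamental hr (memLp_A measurableSet_Icc hu hy))

namespace IsSolution

variable {x : ℝ → Euc n} {x₀ : Euc n} {y₀ : Euc k}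

theorem mono {J J' : Set ℝ} (h : S.IsSolution J u x₀ y₀ x y) (hJ : J' ⊆ J) :
    S.IsSolution J' u x₀ y₀ x y := fun t ht => h t (hJ ht)

theorem continuousOn_fst {T : ℝ} (h : S.IsSolution (Icc 0 T) u x₀ y₀ x y) :
    ContinuousOn x (Icc 0 T) := by
  rcases le_or_gt 0 T with hT | hT
  · have h0 := (h 0 ⟨le_rfl, hT⟩).2.2.1
    refine continuousOn_of_eq_add_integral (h T ⟨hT, le_rfl⟩).1 fun t ht => ?_
    rw [h0, intervalIntegral.integral_same, add_zero]
    exact (h t ht).2.2.1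
  · simp [Icc_eq_empty hT.not_ge]

theorem continuousOn_snd {T : ℝ} (h : S.IsSolution (Icc 0 T) u x₀ y₀ x y) :
    ContinuousOn y (Icc 0 T) := by
  rcases le_or_gt 0 T with hT | hT
  · have h0 := (h 0 ⟨le_rfl, hT⟩).2.2.2
    refine continuousOn_of_eq_add_integral (h T ⟨hT, le_rfl⟩).2.1 fun t ht => ?_
    rw [h0, intervalIntegral.integral_same, add_zero]
    exact (h t ht).2.2.2
  · simp [Icc_eq_empty hT.not_ge]

theorem shift_right {a : ℝ} (ha : 0 ≤ a) (h : S.IsSolution (Ici 0) u x₀ y₀ x y) :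
    S.IsSolution (Ici 0) (shift a u) (x a) (y a) (shift a x) (shift a y) := by
  intro t ht
  have hat : a + t ∈ Ici (0 : ℝ) := add_nonneg ha ht
  obtain ⟨h1, h2, h3, h4⟩ := h _ hat
  obtain ⟨g1, g2, g3, g4⟩ := h a ha
  have i1 := g1.symm.trans h1
  have i2 := g2.symm.trans h2
  refine ⟨?_, ?_, ?_, ?_⟩
  · simpa [shift] using i1.comp_add_left a
  · simpa [shift] using i2.comp_add_left a
  · have := intervalIntegral.integral_comp_add_left (a := 0) (b := t)
      (fun s => S.A (y s) (u s) (x s) + S.b (y s) (u s)) a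
    simp only [shift]
    rw [this, add_zero, h3, ← intervalIntegral.integral_add_adjacent_intervals g1 i1, g3]
    abel
  · have := intervalIntegral.integral_comp_add_left (a := 0) (b := t)
      (fun s => S.f (y s) (u s) + S.c (y s) (x s)) a
    simp only [shift]
    rw [this, add_zero, h4, ← intervalIntegral.integral_add_adjacent_intervals g2 i2, g4]
    abel

/-- The identity `p = qᵀ x₀` turns state estimation into the normal equation `Q x₀ = ∫ q p`, and
observability along this trajectory makes `Q` invertible, so the default value of the inverse never
enters. -/
theorem recon_eq (hr : 0 < r) (hobs : S.StronglyObservable r) (hu : MemLinf (Icc 0 r) S.U u)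
    (h : S.IsSolution (Icc 0 r) u x₀ y₀ x y) : S.recon r y u = x r := by
  have hrr : r ∈ Icc 0 r := ⟨hr.le, le_rfl⟩
  have h00 : (0 : ℝ) ∈ Icc 0 r := ⟨le_rfl, hr.le⟩
  have hxc := h.continuousOn_fst
  have hyc := h.continuousOn_snd
  have hα := memLp_A measurableSet_Icc hu hyc.memLp_top
  have hβ := memLp_b measurableSet_Icc hu hyc.memLp_top
  have hf := memLp_f measurableSet_Icc hu hyc.memLp_top
  have hΦ := isFundamental_transition hr.le hu hyc.memLp_top
  have hcc : ContinuousOn (fun s => S.c (y s)) (Icc 0 r) :=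
    S.c_lip.continuous.comp_continuousOn hyc
  set Φ := S.transition r y u with hΦdef
  set θ := S.theta r y u with hθdef
  set q := S.qMat r y u with hqdef
  have hΦc := hΦ.continuousOn
  have hθ : ∀ t ∈ Icc 0 r, θ t = ∫ s in (0 : ℝ)..t, (S.A (y s) (u s) (θ s) + S.b (y s) (u s)) :=
    fun t ht => hΦ.variation_of_constants_eq hα hβ (fun _ => rfl) ht
  have hθc : ContinuousOn θ (Icc 0 r) := by
    have hw : MemLp (fun s => (Φ s).inverse (S.b (y s) (u s))) ∞ (volume.restrict (Icc 0 r)) :=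
      (hΦ.continuousOn_inverse hα).memLp_top.clm_apply_top hβ
    have hwi := hw.intervalIntegrable_of_top hr.le
    have : ContinuousOn (fun t => ∫ s in (0 : ℝ)..t, (Φ s).inverse (S.b (y s) (u s))) (Icc 0 r) :=
      continuousOn_of_eq_add_integral hwi (by simp)
    refine (hΦc.clm_apply this).congr fun t ht => ?_
    exact (Φ t).intervalIntegral_comp_comm
      ((hw.restrict_Icc_mono le_rfl ht.2).intervalIntegrable_of_top ht.1)
  have hx : ∀ t ∈ Icc 0 r, x t = Φ t x₀ + θ t := fun t ht =>
    hΦ.eq_apply_add hα hβ hθc hθ hxc (fun s hs => (h s hs).2.2.1) ht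
  have hqint : ContinuousOn (fun s => (ContinuousLinearMap.adjoint (Φ s)) ∘L
      (ContinuousLinearMap.adjoint (S.c (y s)))) (Icc 0 r) :=
    ((ContinuousLinearMap.adjoint (𝕜 := ℝ)).continuous.comp_continuousOn hΦc).clm_comp
      ((ContinuousLinearMap.adjoint (𝕜 := ℝ)).continuous.comp_continuousOn hcc)
  have hsub : ∀ {t}, t ∈ Icc 0 r → uIcc 0 t ⊆ Icc 0 r := fun {t} ht => by
    rw [uIcc_of_le ht.1]; exact Icc_subset_Icc_right ht.2
  have hqc : ContinuousOn q (Icc 0 r) :=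
    continuousOn_of_eq_add_integral
      (hqint.mono (hsub hrr)).intervalIntegrable (fun t _ => by simp [hqdef, qMat, ← hΦdef])
  have hcΦ : ∀ v : Euc n, ContinuousOn (fun s => S.c (y s) (Φ s v)) (Icc 0 r) := fun v =>
    hcc.clm_apply (hΦc.clm_apply continuousOn_const)
  have hqadj : ∀ v, ∀ t ∈ Icc 0 r,
      ContinuousLinearMap.adjoint (q t) v = ∫ s in (0 : ℝ)..t, S.c (y s) (Φ s v) := by
    intro v t ht
    refine ext_inner_right ℝ fun w => ?_
    rw [ContinuousLinearMap.adjoint_inner_left]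
    have e1 : q t w = ∫ s in (0 : ℝ)..t, (ContinuousLinearMap.adjoint (Φ s))
        (ContinuousLinearMap.adjoint (S.c (y s)) w) :=
      ContinuousLinearMap.intervalIntegral_apply (hqint.mono (hsub ht)).intervalIntegrable w
    have i1 : IntervalIntegrable (fun s => (ContinuousLinearMap.adjoint (Φ s))
        (ContinuousLinearMap.adjoint (S.c (y s)) w)) volume 0 t :=
      ((hqint.clm_apply (continuousOn_const (c := w))).mono (hsub ht)).intervalIntegrable
    have i2 := ((hcΦ v).mono (hsub ht)).intervalIntegrable (μ := volume)
    have e2 := (innerSL ℝ v).intervalIntegral_comp_comm i1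
    have e3 := (innerSL ℝ w).intervalIntegral_comp_comm i2
    simp only [innerSL_apply_apply] at e2 e3
    rw [e1, ← e2, real_inner_comm, ← e3]
    refine intervalIntegral.integral_congr fun s _ => ?_
    simp only [ContinuousLinearMap.adjoint_inner_right]
    exact real_inner_comm _ _
  have hp : ∀ t ∈ Icc 0 r, S.pVec r y u t = ContinuousLinearMap.adjoint (q t) x₀ := by
    intro t ht
    have hf' := (hf.restrict_Icc_mono le_rfl ht.2).intervalIntegrable_of_top ht.1
    have hcθ : IntervalIntegrable (fun s => S.c (y s) (θ s)) volume 0 t :=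
      ((hcc.clm_apply hθc).mono (hsub ht)).intervalIntegrable
    have hcφ := ((hcΦ x₀).mono (hsub ht)).intervalIntegrable (μ := volume)
    have e : (∫ s in (0 : ℝ)..t, (S.f (y s) (u s) + S.c (y s) (x s)))
        = ∫ s in (0 : ℝ)..t, (S.f (y s) (u s) + (S.c (y s) (Φ s x₀) + S.c (y s) (θ s))) :=
      intervalIntegral.integral_congr fun s hs => by
        simp only [hx s (hsub ht hs), map_add]
    rw [hqadj _ _ ht, pVec, ← hθdef, (h t ht).2.2.2, (h 0 h00).2.2.2,
      intervalIntegral.integral_same, e, intervalIntegral.integral_add hf' (hcφ.add hcθ),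
      intervalIntegral.integral_add hcφ hcθ]
    abel
  have hqqc : ContinuousOn (fun t => q t ∘L ContinuousLinearMap.adjoint (q t)) (Icc 0 r) :=
    hqc.clm_comp ((ContinuousLinearMap.adjoint (𝕜 := ℝ)).continuous.comp_continuousOn hqc)
  have hgram : ∀ v, S.gram r y u v
      = ∫ t in (0 : ℝ)..r, q t (ContinuousLinearMap.adjoint (q t) v) := fun v =>
    ContinuousLinearMap.intervalIntegral_apply (hqqc.mono (hsub hrr)).intervalIntegrable v
  have hinj : Function.Injective (S.gram r y u) := by
    refine (injective_iff_map_eq_zero _).2 fun v hv => ?_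
    have hqv : ContinuousOn (fun t => ContinuousLinearMap.adjoint (q t) v) (Icc 0 r) :=
      ((ContinuousLinearMap.adjoint (𝕜 := ℝ)).continuous.comp_continuousOn hqc).clm_apply
        continuousOn_const
    have i1 : IntervalIntegrable (fun t => q t (ContinuousLinearMap.adjoint (q t) v)) volume 0 r :=
      ((hqc.clm_apply hqv).mono (hsub hrr)).intervalIntegrable
    have e := (innerSL ℝ v).intervalIntegral_comp_comm i1
    rw [← hgram, hv] at e
    have e' : ∀ t, innerSL ℝ v (q t (ContinuousLinearMap.adjoint (q t) v))
        = ‖ContinuousLinearMap.adjoint (q t) v‖ ^ 2 := fun t => by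
      rw [innerSL_apply_apply, ← ContinuousLinearMap.adjoint_inner_left,
        real_inner_self_eq_norm_sq]
    simp only [e', map_zero] at e
    -- `⟪v, Q v⟫ = ∫ ‖qᵀ v‖²`, and a continuous nonnegative function with zero integral vanishes.
    have hz : ∀ t ∈ Icc 0 r, ContinuousLinearMap.adjoint (q t) v = 0 := by
      by_contra! hne
      obtain ⟨t, ht, hne⟩ := hne
      have := intervalIntegral.integral_pos hr (hqv.norm.pow 2)
        (fun s _ => sq_nonneg ‖ContinuousLinearMap.adjoint (q s) v‖)
        ⟨t, ht, pow_pos (norm_pos_iff.2 hne) 2⟩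
      exact this.ne' e
    by_contra hv0
    -- Moving the initial state by `v` changes the integral in the output equation by `q(t)ᵀ v = 0`;
    -- so the same `y` remains an output.
    have hsol : S.IsSolution (Icc 0 r) u (x₀ + v) y₀ (fun s => x s + Φ s v) y := by
      intro t ht
      have hcv := ((hcΦ v).mono (hsub ht)).intervalIntegrable (μ := volume)
      have hav := hΦ.apply_eq v ht
      obtain ⟨h1, h2, h3, h4⟩ := h t ht
      have e1 : ∀ s, S.A (y s) (u s) (x s + Φ s v) + S.b (y s) (u s)
          = (S.A (y s) (u s) (x s) + S.b (y s) (u s)) + S.A (y s) (u s) (Φ s v) := fun s => by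
        rw [map_add]; abel
      have e2 : ∀ s, S.f (y s) (u s) + S.c (y s) (x s + Φ s v)
          = (S.f (y s) (u s) + S.c (y s) (x s)) + S.c (y s) (Φ s v) := fun s => by
        rw [map_add]; abel
      simp only [e1, e2]
      refine ⟨h1.add hav.1, h2.add hcv, ?_, ?_⟩
      · rw [intervalIntegral.integral_add h1 hav.1, h3, hav.2]; abel
      · rw [intervalIntegral.integral_add h2 hcv, ← hqadj v t ht, hz t ht, add_zero]
        exact h4
    obtain ⟨t, -, ht⟩ := hobs u hu (x₀ + v) x₀ y₀ y₀ (by simpa using hv0) _ _ _ _ hsol h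
    simp at ht
  have hinv : (S.gram r y u).IsInvertible :=
    ⟨(LinearEquiv.ofInjectiveEndo (S.gram r y u : Euc n →ₗ[ℝ] Euc n) hinj
      ).toContinuousLinearEquiv, by ext v; rfl⟩
  have hqp : (∫ t in (0 : ℝ)..r, q t (S.pVec r y u t)) = S.gram r y u x₀ := by
    rw [hgram]
    refine intervalIntegral.integral_congr fun t ht => ?_
    simp only [hp t (hsub hrr ht)]
  rw [recon, ← hqdef, ← hΦdef, ← hθdef, hqp, hinv.inverse_apply_self, hx r hrr]

end IsSolution

/-- The input enters `P` only under integrals, whereas `y` also enters pointwise through `y τ - y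
0`; hence the asymmetric hypotheses. -/
theorem recon_congr_ae {y' : ℝ → Euc k} {u' : ℝ → Euc m} (hr : 0 ≤ r)
    (hy : EqOn y y' (Icc 0 r)) (hu : u =ᵐ[volume.restrict (Icc 0 r)] u') :
    S.recon r y u = S.recon r y' u' := by
  have hae := (ae_restrict_iff' measurableSet_Icc).1 hu
  have hcongr : ∀ {E : Type} (F : ℝ → Euc k → Euc m → E), ∀ t ∈ Icc 0 r, ∀ᵐ s,
      s ∈ uIoc 0 t → F s (y s) (u s) = F s (y' s) (u' s) := by
    intro E F t ht
    filter_upwards [hae] with s hs hst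
    rw [uIoc_of_le ht.1] at hst
    have hs' : s ∈ Icc 0 r := ⟨hst.1.le, hst.2.trans ht.2⟩
    rw [hs hs', hy hs']
  have hint : ∀ {E : Type} [NormedAddCommGroup E] [NormedSpace ℝ E]
      (F : ℝ → Euc k → Euc m → E), ∀ t ∈ Icc 0 r,
      ∫ s in (0 : ℝ)..t, F s (y s) (u s) = ∫ s in (0 : ℝ)..t, F s (y' s) (u' s) :=
    fun F t ht => intervalIntegral.integral_congr_ae (hcongr F t ht)
  have hIcc : ∀ {E : Type} [NormedAddCommGroup E] [NormedSpace ℝ E] {F F' : ℝ → E},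
      EqOn F F' (Icc 0 r) → ∀ t ∈ Icc 0 r, ∫ s in (0 : ℝ)..t, F s = ∫ s in (0 : ℝ)..t, F' s :=
    fun h t ht => intervalIntegral.integral_congr fun s hs => by
      rw [uIcc_of_le ht.1] at hs
      exact h ⟨hs.1, hs.2.trans ht.2⟩
  have hrr : r ∈ Icc 0 r := ⟨hr, le_rfl⟩
  -- The two defining predicates coincide, so `Classical.epsilon` returns the same function; no
  -- uniqueness of solutions is involved.
  have htr : S.transition r y u = S.transition r y' u' := by
    unfold transition
    congr 1
    funext Φ
    refine propext (forall₂_congr fun t ht => and_congr ?_ ?_)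
    · refine intervalIntegrable_congr_ae ?_
      rw [EventuallyEq, ae_restrict_iff' measurableSet_uIoc]
      exact hcongr (fun s w v => S.A w v ∘L Φ s) t ht
    · rw [hint (fun s w v => S.A w v ∘L Φ s) t ht]
  have hth : EqOn (S.theta r y u) (S.theta r y' u') (Icc 0 r) := fun t ht => by
    unfold theta
    rw [htr]
    exact hint (fun s w v => S.transition r y' u' t ((S.transition r y' u' s).inverse
      (S.b w v))) t ht
  have hq : EqOn (S.qMat r y u) (S.qMat r y' u') (Icc 0 r) := fun t ht => by
    unfold qMat
    rw [htr]
    exact hint (fun s w _ => ContinuousLinearMap.adjoint (S.transition r y' u' s) ∘L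
      ContinuousLinearMap.adjoint (S.c w)) t ht
  have hp : EqOn (S.pVec r y u) (S.pVec r y' u') (Icc 0 r) := fun t ht => by
    have : (∫ s in (0 : ℝ)..t, S.c (y s) (S.theta r y u s))
        = ∫ s in (0 : ℝ)..t, S.c (y' s) (S.theta r y' u' s) :=
      hIcc (fun s hs => by simp only [hth hs, hy hs]) t ht
    rw [pVec, pVec, this, hint (fun _ w v => S.f w v) t ht, hy ht, hy ⟨le_rfl, hr⟩]
  have hgram : S.gram r y u = S.gram r y' u' :=
    hIcc (fun s hs => by simp only [hq hs]) r hrr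
  have hqp : (∫ t in (0 : ℝ)..r, S.qMat r y u t (S.pVec r y u t))
      = ∫ t in (0 : ℝ)..r, S.qMat r y' u' t (S.pVec r y' u' t) :=
    hIcc (fun s hs => by simp only [hq hs, hp hs]) r hrr
  rw [recon, recon, hqp, htr, hth hrr, hgram]

end ControlSystem

/-! ### True suprema, shifted windows and bounded representatives -/

section SupNorm

variable {d : ℕ} {I : Set ℝ} {g : ℝ → Euc d}

theorem supNormOn_le_ofReal {C : ℝ} (h : ∀ t ∈ I, ‖g t‖ ≤ C) :
    supNormOn I g ≤ ENNReal.ofReal C :=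
  iSup₂_le fun t ht => by
    rw [← ofReal_norm]
    exact ENNReal.ofReal_le_ofReal (h t ht)

theorem exists_norm_le_of_supNormOn_lt_top (h : supNormOn I g < ⊤) :
    ∃ C : ℝ, 0 ≤ C ∧ ∀ t ∈ I, ‖g t‖ ≤ C := by
  refine ⟨(supNormOn I g).toReal, ENNReal.toReal_nonneg, fun t ht => ?_⟩
  rw [← toReal_enorm]
  exact ENNReal.toReal_mono h.ne (le_iSup₂ (f := fun t (_ : t ∈ I) => ‖g t‖ₑ) t ht)

theorem norm_lt_of_supNormOn_lt {δ : ℝ} (h : supNormOn I g < ENNReal.ofReal δ) {t : ℝ}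
    (ht : t ∈ I) : ‖g t‖ < δ := by
  have := (le_iSup₂ (f := fun t (_ : t ∈ I) => ‖g t‖ₑ) t ht).trans_lt h
  rw [← ofReal_norm] at this
  exact (ENNReal.ofReal_lt_ofReal_iff_of_nonneg (norm_nonneg _)).1 this

end SupNorm

section Shift

variable {d : ℕ} {U : Set (Euc d)} {u u' : ℝ → Euc d} {a r : ℝ}

theorem measurePreserving_add_left_Icc (a r : ℝ) :
    MeasurePreserving (fun s : ℝ => a + s) (volume.restrict (Icc 0 r))
      (volume.restrict (Icc a (a + r))) := by
  have := (measurePreserving_add_left volume a).restrict_preimage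
    (s := Icc a (a + r)) measurableSet_Icc
  simpa using this

theorem memLinf_shift (hu : MemLinf (Ici 0) U u) (ha : 0 ≤ a) :
    MemLinf (Icc 0 r) U (shift a u) := by
  refine ⟨?_, fun t ht => hu.2 _ (add_nonneg ha ht.1)⟩
  have h : MemLp u ∞ (volume.restrict (Icc a (a + r))) :=
    hu.1.mono_measure (Measure.restrict_mono (fun t ht => ha.trans ht.1) le_rfl)
  exact h.comp_measurePreserving (measurePreserving_add_left_Icc a r)

theorem shift_ae_eq (h : u =ᵐ[volume.restrict (Ici 0)] u') (ha : 0 ≤ a) :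
    shift a u =ᵐ[volume.restrict (Icc 0 r)] shift a u' :=
  (measurePreserving_add_left_Icc a r).quasiMeasurePreserving.ae_eq_comp
    (ae_mono (Measure.restrict_mono (fun _ ht => ha.trans ht.1) le_rfl) h)

theorem MemLinf.mono {I J : Set ℝ} (hu : MemLinf J U u) (hI : I ⊆ J) : MemLinf I U u :=
  ⟨hu.1.mono_measure (Measure.restrict_mono hI le_rfl), fun t ht => hu.2 t (hI ht)⟩

theorem MemLinf.add_univ {I : Set ℝ} {g h : ℝ → Euc d} (hg : MemLinf I univ g)
    (hh : MemLinf I univ h) : MemLinf I univ (g + h) :=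
  ⟨hg.1.add hh.1, fun _ _ => mem_univ _⟩

theorem MemLinf.memLinfLoc (hu : MemLinf (Ici 0) U u) : MemLinfLoc U u :=
  fun _ _ => hu.mono Icc_subset_Ici_self

/-- Exceptional values of `u` are replaced by `u 0`, which keeps the values in `U`. -/
theorem MemLinf.exists_ae_eq_bounded (hu : MemLinf (Ici 0) U u) :
    ∃ (M : ℝ) (u' : ℝ → Euc d), MemLinf (Ici 0) U u' ∧ u =ᵐ[volume.restrict (Ici 0)] u' ∧
      ∀ t ∈ Ici (0 : ℝ), ‖u' t‖ ≤ M := by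
  classical
  obtain ⟨C, -, hC⟩ := hu.1.exists_ae_norm_le
  set v := u 0 with hv
  have hae : u =ᵐ[volume.restrict (Ici 0)] fun t => if ‖u t‖ ≤ C then u t else v := by
    filter_upwards [hC] with t ht
    rw [if_pos ht]
  refine ⟨max C ‖v‖, _, ⟨hu.1.ae_eq hae, fun t ht => ?_⟩, hae, fun t _ => ?_⟩
  · split_ifs
    · exact hu.2 t ht
    · exact hu.2 0 self_mem_Ici
  · split_ifs with h
    · exact h.trans (le_max_left _ _)
    · exact le_max_right _ _

end Shift

/-! ### Perturbation estimates -/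

theorem norm_sub_le_of_linear {V : Type*} [NormedAddCommGroup V] [NormedSpace ℝ V]
    {α α' : ℝ → V →L[ℝ] V} {β β' z x : ℝ → V} {a b L η M : ℝ} (hL : 0 ≤ L) (hη : 0 ≤ η)
    (hM : 0 ≤ M) (hab : a ≤ b)
    (hzi : IntervalIntegrable (fun s => α s (z s) + β s) volume a b)
    (hz : ∀ t ∈ Icc a b, z t = z a + ∫ s in a..t, (α s (z s) + β s))
    (hxi : IntervalIntegrable (fun s => α' s (x s) + β' s) volume a b)
    (hx : ∀ t ∈ Icc a b, x t = x a + ∫ s in a..t, (α' s (x s) + β' s))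
    (hxM : ∀ s ∈ Icc a b, ‖x s‖ ≤ M)
    (hα : ∀ᵐ s ∂volume.restrict (Icc a b), ‖α s‖ ≤ L)
    (hαα : ∀ᵐ s ∂volume.restrict (Icc a b), ‖α s - α' s‖ ≤ η)
    (hββ : ∀ᵐ s ∂volume.restrict (Icc a b), ‖β s - β' s‖ ≤ η) :
    ‖z b - x b‖ ≤ (‖z a - x a‖ + η * (M + 1) * (b - a)) * Real.exp (L * (b - a)) := by
  have hsub : ∀ {g : ℝ → V}, IntervalIntegrable g volume a b → ∀ t ∈ Icc a b,
      IntervalIntegrable g volume a t := fun hg t ht => hg.mono_set (by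
    rw [uIcc_of_le ht.1, uIcc_of_le hab]; exact Icc_subset_Icc_right ht.2)
  refine norm_le_of_eq_add_integral (z := fun s => z s - x s)
    (g := fun s => (α s (z s) + β s) - (α' s (x s) + β' s)) hL (by positivity) hab
    (hzi.sub hxi) (fun t ht => ?_) ?_
  · rw [intervalIntegral.integral_sub (hsub hzi t ht) (hsub hxi t ht), hz t ht, hx t ht]
    abel
  · filter_upwards [hα, hαα, hββ, ae_restrict_mem measurableSet_Icc] with s h1 h2 h3 hs
    -- The coefficient difference is made to act on `x`, for which the bound `M` is known, rather
    -- than on `z`; this produces the constant `η * (M + 1)`.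
    have e : (α s (z s) + β s) - (α' s (x s) + β' s)
        = α s (z s - x s) + ((α s - α' s) (x s) + (β s - β' s)) := by
      simp only [map_sub, sub_apply]; abel
    rw [e]
    calc _ ≤ ‖α s (z s - x s)‖ + (‖(α s - α' s) (x s)‖ + ‖β s - β' s‖) :=
          (norm_add_le _ _).trans (add_le_add le_rfl (norm_add_le _ _))
      _ ≤ L * ‖z s - x s‖ + (η * M + η) :=
          add_le_add ((α s).le_of_opNorm_le h1 _)
            (add_le_add (((α s - α' s)).le_of_opNorm_le_of_le h2 (hxM s hs)) h3)
      _ = _ := by ring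

theorem exists_norm_le_of_continuousOn_prod {X₁ X₂ Y : Type*} [NormedAddCommGroup X₁]
    [ProperSpace X₁] [NormedAddCommGroup X₂] [ProperSpace X₂] [NormedAddCommGroup Y]
    {U : Set X₂} (hU : IsClosed U) {F : X₁ → X₂ → Y}
    (hF : ContinuousOn (fun p : X₁ × X₂ => F p.1 p.2) (univ ×ˢ U)) (R C : ℝ) :
    ∃ L : ℝ, 0 ≤ L ∧ ∀ y v, ‖y‖ ≤ R → ‖v‖ ≤ C → v ∈ U → ‖F y v‖ ≤ L := by
  have hK : IsCompact (Metric.closedBall (0 : X₁) R ×ˢ (Metric.closedBall (0 : X₂) C ∩ U)) :=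
    (isCompact_closedBall _ _).prod ((isCompact_closedBall _ _).inter_right hU)
  obtain ⟨L, hL⟩ := hK.exists_bound_of_continuousOn
    (hF.mono (prod_mono (subset_univ _) inter_subset_right))
  exact ⟨max L 0, le_max_right _ _, fun y v hy hv hvU => (hL (y, v)
    ⟨by simpa using hy, by simpa using hv, hvU⟩).trans (le_max_left _ _)⟩

theorem exists_norm_sub_le_of_continuousOn_prod {X₁ X₂ Y : Type*} [NormedAddCommGroup X₁]
    [ProperSpace X₁] [NormedAddCommGroup X₂] [ProperSpace X₂] [NormedAddCommGroup Y]
    {U : Set X₂} (hU : IsClosed U) {F : X₁ → X₂ → Y}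
    (hF : ContinuousOn (fun p : X₁ × X₂ => F p.1 p.2) (univ ×ˢ U)) (R C : ℝ) {η : ℝ}
    (hη : 0 < η) :
    ∃ δ : ℝ, 0 < δ ∧ ∀ y y' v, ‖y‖ ≤ R → ‖y'‖ ≤ R → ‖v‖ ≤ C → v ∈ U → ‖y - y'‖ ≤ δ →
      ‖F y v - F y' v‖ ≤ η := by
  have hK : IsCompact (Metric.closedBall (0 : X₁) R ×ˢ (Metric.closedBall (0 : X₂) C ∩ U)) :=
    (isCompact_closedBall _ _).prod ((isCompact_closedBall _ _).inter_right hU)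
  obtain ⟨δ, hδ, h⟩ := Metric.uniformContinuousOn_iff.1 (hK.uniformContinuousOn_of_continuous
    (hF.mono (prod_mono (subset_univ _) inter_subset_right))) η hη
  refine ⟨δ / 2, half_pos hδ, fun y y' v hy hy' hv hvU hyy => ?_⟩
  have := h (y, v) ⟨by simpa using hy, by simpa using hv, hvU⟩ (y', v)
    ⟨by simpa using hy', by simpa using hv, hvU⟩ (by
      rw [dist_prod_same_right, dist_eq_norm]; linarith)
  rw [dist_eq_norm] at this
  exact this.le

theorem floor_div_eq_iff {r t : ℝ} (hr : 0 < r) (ht : 0 ≤ t) {i : ℕ} :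
    ⌊t / r⌋₊ = i ↔ t ∈ Ico ((i : ℝ) * r) (((i : ℝ) + 1) * r) := by
  rw [Nat.floor_eq_iff (by positivity), le_div_iff₀ hr, div_lt_iff₀ hr, mem_Ico]

/-! ### The observer: error estimates, existence and uniqueness -/

namespace ControlSystem

variable {n k m : ℕ} {S : ControlSystem n k m} {r : ℝ} {u : ℝ → Euc m} {y e w : ℝ → Euc k}
  {x z : ℝ → Euc n} {x₀ z₀ : Euc n} {y₀ : Euc k}

theorem IsSolution.eq_add_integral (h : S.IsSolution (Ici 0) u x₀ y₀ x y) {a b : ℝ} (ha : 0 ≤ a)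
    (hab : a ≤ b) :
    IntervalIntegrable (fun s => S.A (y s) (u s) (x s) + S.b (y s) (u s)) volume a b ∧
      x b = x a + ∫ s in a..b, (S.A (y s) (u s) (x s) + S.b (y s) (u s)) := by
  obtain ⟨h1, -, h3, -⟩ := h b (ha.trans hab)
  obtain ⟨g1, -, g3, -⟩ := h a ha
  refine ⟨g1.symm.trans h1, ?_⟩
  rw [h3, g3, ← intervalIntegral.integral_add_adjacent_intervals g1 (g1.symm.trans h1)]
  abel

theorem BoundedTrajectories.exists_bound (hbdd : S.BoundedTrajectories)
    (hu : MemLinf (Ici 0) S.U u) (h : S.IsSolution (Ici 0) u x₀ y₀ x y) :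
    ∃ M : ℝ, 0 ≤ M ∧ (∀ t ∈ Ici (0 : ℝ), ‖x t‖ ≤ M) ∧ ∀ t ∈ Ici (0 : ℝ), ‖y t‖ ≤ M := by
  have := hbdd x₀ y₀ u hu x y h
  rw [ENNReal.add_lt_top] at this
  obtain ⟨C, hC0, hC⟩ := exists_norm_le_of_supNormOn_lt_top this.1
  obtain ⟨D, hD0, hD⟩ := exists_norm_le_of_supNormOn_lt_top this.2
  exact ⟨max C D, le_max_of_le_left hC0, fun t ht => (hD t ht).trans (le_max_right _ _),
    fun t ht => (hC t ht).trans (le_max_left _ _)⟩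

theorem IsSolution.memLinf_snd (h : S.IsSolution (Ici 0) u x₀ y₀ x y) {M : ℝ}
    (hM : ∀ t ∈ Ici (0 : ℝ), ‖y t‖ ≤ M) : MemLinf (Ici 0) univ y := by
  have hc : ContinuousOn y (Ici 0) := fun t ht => by
    have h1 : ContinuousOn y (Icc 0 (t + 1)) := (h.mono Icc_subset_Ici_self).continuousOn_snd
    refine (h1 t ⟨ht, by linarith⟩).mono_of_mem_nhdsWithin ?_
    rw [← Ici_inter_Iic]
    exact inter_mem_nhdsWithin _ (Iic_mem_nhds (by linarith))
  exact ⟨memLp_top_of_bound (hc.aestronglyMeasurable measurableSet_Ici) M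
    ((ae_restrict_iff' measurableSet_Ici).2 (.of_forall hM)), fun _ _ => mem_univ _⟩

/-- The bound does not depend on the window: all shifts of the bounded representative of `u` lie in
one bounded set of inputs, to which (R2) applies once. -/
theorem exists_norm_recon_le (hr : 0 ≤ r) (hP : S.ReconCompletelyContinuous r)
    (hu : MemLinf (Ici 0) S.U u) (R : ℝ) :
    ∃ K : ℝ, 0 ≤ K ∧ ∀ a, 0 ≤ a → ∀ w, MemLinf (Ici 0) univ w →
      (∀ t ∈ Icc a (a + r), ‖w t‖ ≤ R) → ‖S.recon r (shift a w) (shift a u)‖ ≤ K := by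
  obtain ⟨M, u', hu', huu', hM⟩ := hu.exists_ae_eq_bounded
  obtain ⟨hb, -⟩ := hP {g | MemLinf (Icc 0 r) univ g ∧ supNormOn (Icc 0 r) g ≤ R.toNNReal}
    {v | MemLinf (Icc 0 r) S.U v ∧ supNormOn (Icc 0 r) v ≤ M.toNNReal}
    (fun g hg => hg.1) (fun v hv => hv.1) ⟨_, fun g hg => hg.2⟩ ⟨_, fun v hv => hv.2⟩
  obtain ⟨K, hK⟩ := hb.exists_norm_le
  refine ⟨max K 0, le_max_right _ _, fun a ha w hw hwR => ?_⟩
  rw [recon_congr_ae hr (fun _ _ => rfl) (shift_ae_eq huu' ha)]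
  refine (hK _ (mem_image2_of_mem ⟨memLinf_shift hw ha, supNormOn_le_ofReal fun t ht => ?_⟩
    ⟨memLinf_shift hu' ha, supNormOn_le_ofReal fun t ht => hM _ (add_nonneg ha ht.1)⟩)).trans
    (le_max_left _ _)
  exact hwR _ ⟨by linarith [ht.1], by linarith [ht.2]⟩

/-- By exactness, `x (a + r)` is `P` evaluated at the uncorrupted output, so (R2) compares the two
values with a `δ` valid for all windows. -/
theorem exists_norm_recon_sub_le (hr : 0 < r) (hobs : S.StronglyObservable r)
    (hP : S.ReconCompletelyContinuous r) (hu : MemLinf (Ici 0) S.U u)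
    (h : S.IsSolution (Ici 0) u x₀ y₀ x y) {R : ℝ} (hR : ∀ t ∈ Ici (0 : ℝ), ‖y t‖ ≤ R) {ε : ℝ}
    (hε : 0 < ε) :
    ∃ δ : ℝ, 0 < δ ∧ ∀ a, 0 ≤ a → ∀ e, MemLinf (Ici 0) univ e →
      (∀ t ∈ Icc a (a + r), ‖e t‖ ≤ δ) →
        ‖S.recon r (shift a (y + e)) (shift a u) - x (a + r)‖ ≤ ε := by
  obtain ⟨M, u', hu', huu', hM⟩ := hu.exists_ae_eq_bounded
  obtain ⟨-, hc⟩ := hP {g | MemLinf (Icc 0 r) univ g ∧ supNormOn (Icc 0 r) g ≤ (R + 1).toNNReal}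
    {v | MemLinf (Icc 0 r) S.U v ∧ supNormOn (Icc 0 r) v ≤ M.toNNReal}
    (fun g hg => hg.1) (fun v hv => hv.1) ⟨_, fun g hg => hg.2⟩ ⟨_, fun v hv => hv.2⟩
  obtain ⟨δ, hδ, hc⟩ := hc ε hε
  -- The bound `1` keeps `y + e` in the ball of radius `R + 1`; the half makes the supremum strictly
  -- smaller than `δ`.
  refine ⟨min (δ / 2) 1, by positivity, fun a ha e he hea => ?_⟩
  have hshift : ∀ t ∈ Icc 0 r, ‖e (a + t)‖ ≤ min (δ / 2) 1 := fun t ht =>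
    hea _ ⟨by linarith [ht.1], by linarith [ht.2]⟩
  have hy := h.memLinf_snd hR
  have hx : x (a + r) = S.recon r (shift a y) (shift a u') := by
    rw [← recon_congr_ae hr.le (fun _ _ => rfl) (shift_ae_eq huu' ha)]
    exact (((h.shift_right ha).mono Icc_subset_Ici_self).recon_eq hr hobs
      (memLinf_shift hu ha)).symm
  rw [hx, recon_congr_ae hr.le (fun _ _ => rfl) (shift_ae_eq huu' ha)]
  refine (hc _ ⟨memLinf_shift (hy.add_univ he) ha, supNormOn_le_ofReal fun t ht => ?_⟩ _
    ⟨memLinf_shift hy ha, supNormOn_le_ofReal fun t ht => ?_⟩ _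
    ⟨memLinf_shift hu' ha, supNormOn_le_ofReal fun t ht => hM _ (add_nonneg ha ht.1)⟩ ?_).le
  · exact (norm_add_le _ _).trans (add_le_add (hR _ (add_nonneg ha ht.1))
      ((hshift t ht).trans (min_le_right _ _)))
  · exact (hR _ (add_nonneg ha ht.1)).trans (by linarith)
  · refine (supNormOn_le_ofReal (C := δ / 2) fun t ht => ?_).trans_lt
      ((ENNReal.ofReal_lt_ofReal_iff hδ).2 (half_lt_self hδ))
    have : (shift a (y + e) - shift a y) t = e (a + t) := by simp [shift]
    rw [this]
    exact (hshift t ht).trans (min_le_left _ _)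

theorem IsObserver.norm_sub_le (hO : S.IsObserver r u w z₀ z)
    (h : S.IsSolution (Ici 0) u x₀ y₀ x y) (hr : 0 ≤ r) {M L η : ℝ} (hM0 : 0 ≤ M) (hL : 0 ≤ L)
    (hη : 0 ≤ η) (hM : ∀ t ∈ Ici (0 : ℝ), ‖x t‖ ≤ M) {i : ℕ}
    (hae : ∀ᵐ s ∂volume.restrict (Ici (0 : ℝ)), s ∈ Ico ((i : ℝ) * r) (((i : ℝ) + 1) * r) →
      ‖S.A (w s) (u s)‖ ≤ L ∧ ‖S.A (w s) (u s) - S.A (y s) (u s)‖ ≤ η ∧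
        ‖S.b (w s) (u s) - S.b (y s) (u s)‖ ≤ η) {t : ℝ}
    (ht : t ∈ Ico ((i : ℝ) * r) (((i : ℝ) + 1) * r)) :
    ‖z t - x t‖ ≤ (‖z (i * r) - x (i * r)‖ + η * (M + 1) * r) * Real.exp (L * r) := by
  have ha : 0 ≤ (i : ℝ) * r := by positivity
  have hae' : ∀ᵐ s ∂volume.restrict (Icc ((i : ℝ) * r) t), ‖S.A (w s) (u s)‖ ≤ L ∧
      ‖S.A (w s) (u s) - S.A (y s) (u s)‖ ≤ η ∧ ‖S.b (w s) (u s) - S.b (y s) (u s)‖ ≤ η := by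
    filter_upwards [ae_mono (Measure.restrict_mono (fun s hs => ha.trans hs.1) le_rfl) hae,
      ae_restrict_mem measurableSet_Icc] with s hs hst
    exact hs ⟨hst.1, hst.2.trans_lt ht.2⟩
  have hx := h.eq_add_integral ha ht.1
  have htr : t - i * r ≤ r := by linarith [ht.2]
  have ht0 : 0 ≤ t - i * r := sub_nonneg.2 ht.1
  refine (norm_sub_le_of_linear hL hη hM0 ht.1 (hO.2.1 i t ht).1
    (fun s hs => (hO.2.1 i s ⟨hs.1, hs.2.trans_lt ht.2⟩).2) hx.1
    (fun s hs => (h.eq_add_integral ha hs.1).2) (fun s hs => hM s (ha.trans hs.1))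
    (hae'.mono fun s hs => hs.1) (hae'.mono fun s hs => hs.2.1)
    (hae'.mono fun s hs => hs.2.2)).trans ?_
  gcongr

/-- No smallness of `e` is available, so the coefficient differences are bounded crudely, by `2 * L`
and `2 * L'`. -/
theorem exists_norm_sub_le_of_bounded (hr : 0 ≤ r) (hu : MemLinf (Ici 0) S.U u)
    (h : S.IsSolution (Ici 0) u x₀ y₀ x y) {M : ℝ} (hM0 : 0 ≤ M)
    (hxM : ∀ t ∈ Ici (0 : ℝ), ‖x t‖ ≤ M) (hyM : ∀ t ∈ Ici (0 : ℝ), ‖y t‖ ≤ M) {R : ℝ}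
    (hR : 0 ≤ R) :
    ∃ K : ℝ, 0 ≤ K ∧ ∃ L : ℝ, ∀ e z₀ z, S.IsObserver r u (y + e) z₀ z → ∀ i : ℕ,
      (∀ t ∈ Ico ((i : ℝ) * r) (((i : ℝ) + 1) * r), ‖e t‖ ≤ R) →
      ∀ t ∈ Ico ((i : ℝ) * r) (((i : ℝ) + 1) * r),
        ‖z t - x t‖ ≤ (‖z (i * r) - x (i * r)‖ + K) * Real.exp L := by
  obtain ⟨C, -, hC⟩ := hu.1.exists_ae_norm_le
  obtain ⟨L, hL0, hL⟩ := exists_norm_le_of_continuousOn_prod S.U_closed S.A_lip.continuousOn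
    (M + R) C
  obtain ⟨L', hL'0, hL'⟩ := exists_norm_le_of_continuousOn_prod S.U_closed S.b_lip.continuousOn
    (M + R) C
  refine ⟨(2 * L + 2 * L') * (M + 1) * r, by positivity, L * r, fun e z₀ z hO i he t ht =>
    hO.norm_sub_le h hr hM0 hL0 (by positivity) hxM ?_ ht⟩
  filter_upwards [hC, ae_restrict_mem measurableSet_Ici] with s hs hs0 hsi
  have hw : ‖(y + e) s‖ ≤ M + R := (norm_add_le _ _).trans (add_le_add (hyM s hs0) (he s hsi))
  have hy : ‖y s‖ ≤ M + R := (hyM s hs0).trans (by linarith)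
  have hU := hu.2 s hs0
  refine ⟨hL _ _ hw hs hU, (norm_sub_le _ _).trans ?_, (norm_sub_le _ _).trans ?_⟩
  · linarith [hL _ _ hw hs hU, hL _ _ hy hs hU]
  · linarith [hL' _ _ hw hs hU, hL' _ _ hy hs hU]

/-- The starting index `i` is free so that one statement serves errors small from the beginning and
errors small only eventually. `δ` depends on neither `i` nor `z₀`. -/
theorem exists_norm_sub_le_of_small (hr : 0 < r) (hobs : S.StronglyObservable r)
    (hP : S.ReconCompletelyContinuous r) (hu : MemLinf (Ici 0) S.U u)
    (h : S.IsSolution (Ici 0) u x₀ y₀ x y) {M : ℝ} (hM0 : 0 ≤ M)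
    (hxM : ∀ t ∈ Ici (0 : ℝ), ‖x t‖ ≤ M) (hyM : ∀ t ∈ Ici (0 : ℝ), ‖y t‖ ≤ M) {ε : ℝ}
    (hε : 0 < ε) :
    ∃ δ : ℝ, 0 < δ ∧ ∀ e z₀ z, MemLinf (Ici 0) univ e → S.IsObserver r u (y + e) z₀ z → ∀ i : ℕ,
      (∀ t ∈ Ici ((i : ℝ) * r), ‖e t‖ ≤ δ) →
      ∀ t ∈ Ici (((i : ℝ) + 1) * r), ‖z t - x t‖ ≤ ε := by
  obtain ⟨C, -, hC⟩ := hu.1.exists_ae_norm_le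
  obtain ⟨L, hL0, hL⟩ := exists_norm_le_of_continuousOn_prod S.U_closed S.A_lip.continuousOn
    (M + 1) C
  -- The reset error and the drift `η * (M + 1) * r` each get the share `ε₁`; the Gronwall factor
  -- then brings their sum to `ε`.
  set ε₁ : ℝ := ε / (2 * Real.exp (L * r)) with hε₁
  have hε₁0 : 0 < ε₁ := by positivity
  set η : ℝ := ε₁ / ((M + 1) * r) with hη
  have hη0 : 0 < η := by positivity
  obtain ⟨δ₁, hδ₁, h₁⟩ := exists_norm_sub_le_of_continuousOn_prod S.U_closed S.A_lip.continuousOn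
    (M + 1) C hη0
  obtain ⟨δ₂, hδ₂, h₂⟩ := exists_norm_sub_le_of_continuousOn_prod S.U_closed S.b_lip.continuousOn
    (M + 1) C hη0
  obtain ⟨δ₃, hδ₃, h₃⟩ := exists_norm_recon_sub_le hr hobs hP hu h hyM hε₁0
  refine ⟨min 1 (min δ₁ (min δ₂ δ₃)), by positivity, fun e z₀ z he hO i hei t ht => ?_⟩
  simp only [le_min_iff] at hei
  have ht0 : 0 ≤ t := le_trans (by positivity) ht
  -- The sampling interval of `t` begins with a reset computed from the window `j`, and `i ≤ j`
  -- ensures that `e` is already small there.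
  obtain ⟨j, hj⟩ : ∃ j, ⌊t / r⌋₊ = j + 1 ∧ i ≤ j := by
    have : i + 1 ≤ ⌊t / r⌋₊ := Nat.le_floor (by
      rw [le_div_iff₀ hr]; push_cast; exact ht)
    exact ⟨⌊t / r⌋₊ - 1, by omega, by omega⟩
  have htj := (floor_div_eq_iff hr ht0).1 hj.1
  have hij : (i : ℝ) * r ≤ j * r := by gcongr; exact_mod_cast hj.2
  have hj0 : 0 ≤ (j : ℝ) * r := by positivity
  have hreset : ‖z ((j + 1 : ℕ) * r) - x ((j + 1 : ℕ) * r)‖ ≤ ε₁ := by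
    have := h₃ (j * r) hj0 e he (fun s hs => (hei s (hij.trans hs.1)).2.2.2)
    rw [← hO.2.2 j] at this
    have e1 : (j : ℝ) * r + r = (j + 1) * r := by ring
    push_cast
    rwa [e1] at this
  have hae : ∀ᵐ s ∂volume.restrict (Ici (0 : ℝ)),
      s ∈ Ico (((j + 1 : ℕ) : ℝ) * r) ((((j + 1 : ℕ) : ℝ) + 1) * r) →
      ‖S.A ((y + e) s) (u s)‖ ≤ L ∧ ‖S.A ((y + e) s) (u s) - S.A (y s) (u s)‖ ≤ η ∧
        ‖S.b ((y + e) s) (u s) - S.b (y s) (u s)‖ ≤ η := by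
    filter_upwards [hC, ae_restrict_mem measurableSet_Ici] with s hs hs0 hsi
    have hsi' : (i : ℝ) * r ≤ s := by
      have := hsi.1
      push_cast at this
      linarith
    obtain ⟨e0, e1, e2, -⟩ := hei s hsi'
    have hw : ‖(y + e) s‖ ≤ M + 1 := (norm_add_le _ _).trans (add_le_add (hyM s hs0) e0)
    have hy : ‖y s‖ ≤ M + 1 := (hyM s hs0).trans (by linarith)
    have hd : (y + e) s - y s = e s := by simp
    have hU := hu.2 s hs0
    exact ⟨hL _ _ hw hs hU, h₁ _ _ _ hw hy hs hU (hd ▸ e1), h₂ _ _ _ hw hy hs hU (hd ▸ e2)⟩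
  refine (hO.norm_sub_le h hr.le hM0 hL0 hη0.le hxM hae htj).trans ?_
  have e2 : η * (M + 1) * r = ε₁ := by rw [hη]; field_simp
  rw [e2]
  calc _ ≤ (ε₁ + ε₁) * Real.exp (L * r) := by gcongr
    _ = ε := by rw [hε₁]; field_simp; ring

theorem exists_isObserver (hr : 0 < r) (hu : MemLinf (Ici 0) S.U u)
    (hw : ∀ T, MemLp w ∞ (volume.restrict (Icc 0 T))) (z₀ : Euc n) :
    ∃ z, S.IsObserver r u w z₀ z := by
  -- The reset values depend on `w` and `u` but not on `z`, so the equations on the sampling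
  -- intervals decouple and are solved independently, then glued.
  let v : ℕ → Euc n := fun i =>
    Nat.casesOn i z₀ fun i => S.recon r (shift (i * r) w) (shift (i * r) u)
  have hle : ∀ i : ℕ, (i : ℝ) * r ≤ ((i : ℝ) + 1) * r := fun i => by gcongr; linarith
  have h0 : ∀ i : ℕ, 0 ≤ (i : ℝ) * r := fun i => by positivity
  have hw' : ∀ i : ℕ, MemLp w ∞ (volume.restrict (Icc ((i : ℝ) * r) (((i : ℝ) + 1) * r))) :=
    fun i => (hw _).restrict_Icc_mono (h0 i) le_rfl
  have hu' : ∀ i : ℕ, MemLinf (Icc ((i : ℝ) * r) (((i : ℝ) + 1) * r)) S.U u := fun i =>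
    hu.mono fun t ht => (h0 i).trans ht.1
  have hA := fun i => memLp_A measurableSet_Icc (hu' i) (hw' i)
  have hb := fun i => memLp_b measurableSet_Icc (hu' i) (hw' i)
  choose Z hZc hZ using fun i => exists_eq_add_integral_linear (hle i) (hA i) (hb i) (v i)
  have hz : ∀ i : ℕ, ∀ t ∈ Ico ((i : ℝ) * r) (((i : ℝ) + 1) * r), Z ⌊t / r⌋₊ t = Z i t :=
    fun i t ht => by rw [(floor_div_eq_iff hr ((h0 i).trans ht.1)).2 ht]
  have hlt : ∀ i : ℕ, (i : ℝ) * r < ((i : ℝ) + 1) * r := fun i => by gcongr; linarith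
  have hzi : ∀ i : ℕ, Z ⌊(i : ℝ) * r / r⌋₊ (i * r) = v i := fun i => by
    rw [hz i _ ⟨le_rfl, hlt i⟩, hZ i _ ⟨le_rfl, hle i⟩, intervalIntegral.integral_same, add_zero]
  refine ⟨fun t => Z ⌊t / r⌋₊ t, ?_, fun i t ht => ?_, fun i => ?_⟩
  · simpa using! hzi 0
  · have hcongr : EqOn (fun s => S.A (w s) (u s) (Z i s) + S.b (w s) (u s))
        (fun s => S.A (w s) (u s) (Z ⌊s / r⌋₊ s) + S.b (w s) (u s)) (uIcc ((i : ℝ) * r) t) := by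
      intro s hs
      rw [uIcc_of_le ht.1] at hs
      simp only [hz i s ⟨hs.1, hs.2.trans_lt ht.2⟩]
    constructor
    · have := ((((hA i).clm_apply_top (hZc i).memLp_top).add (hb i)).restrict_Icc_mono le_rfl
        ht.2.le).intervalIntegrable_of_top ht.1
      exact this.congr (hcongr.mono uIoc_subset_uIcc)
    · beta_reduce
      rw [← intervalIntegral.integral_congr hcongr, hzi, hz i t ht]
      exact hZ i t ⟨ht.1, ht.2.le⟩
  · have := hzi (i + 1)
    push_cast at this
    exact this

theorem IsObserver.eqOn {z' : ℝ → Euc n} (hr : 0 < r) (hu : MemLinf (Ici 0) S.U u)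
    (hw : ∀ T, MemLp w ∞ (volume.restrict (Icc 0 T))) (h : S.IsObserver r u w z₀ z)
    (h' : S.IsObserver r u w z₀ z') : EqOn z z' (Ici 0) := by
  intro t ht
  set i := ⌊t / r⌋₊ with hi
  have hti := (floor_div_eq_iff hr ht).1 hi.symm
  have h0 : 0 ≤ (i : ℝ) * r := by positivity
  have hstart : z (i * r) = z' (i * r) := by
    cases i with
    | zero => simp [h.1, h'.1]
    | succ j => push_cast; rw [h.2.2, h'.2.2]
  obtain ⟨L, hL0, hL⟩ := ((memLp_A (measurableSet_Icc (a := (i : ℝ) * r) (b := t))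
    (hu.mono fun s hs => h0.trans hs.1) ((hw t).restrict_Icc_mono h0 le_rfl))).exists_ae_norm_le
  have hz : ∀ {z}, S.IsObserver r u w z₀ z → ∀ s ∈ Icc ((i : ℝ) * r) t,
      z s = z (i * r) + ∫ s in ((i : ℝ) * r)..s, (S.A (w s) (u s) (z s) + S.b (w s) (u s)) :=
    fun h s hs => (h.2.1 i s ⟨hs.1, hs.2.trans_lt hti.2⟩).2
  obtain ⟨M, hM⟩ := isCompact_Icc.exists_bound_of_continuousOn
    (continuousOn_of_eq_add_integral (h'.2.1 i t hti).1 (hz h'))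
  -- Both trajectories have the same coefficients, so `η = 0` and the size of `M` is irrelevant.
  have := norm_sub_le_of_linear hL0 le_rfl (le_max_right M 0) hti.1 (h.2.1 i t hti).1 (hz h)
    (h'.2.1 i t hti).1 (hz h') (fun s hs => (hM s hs).trans (le_max_left _ _)) hL
    (.of_forall fun s => by simp) (.of_forall fun s => by simp)
  rw [hstart] at this
  simpa [sub_eq_zero] using this

theorem IsObserver.congr {w' : ℝ → Euc k} (hr : 0 ≤ r) (hww : EqOn w w' (Ici 0))
    (h : S.IsObserver r u w z₀ z) : S.IsObserver r u w' z₀ z := by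
  have h0 : ∀ i : ℕ, 0 ≤ (i : ℝ) * r := fun i => by positivity
  refine ⟨h.1, fun i t ht => ?_, fun i => ?_⟩
  · have hcongr : EqOn (fun s => S.A (w s) (u s) (z s) + S.b (w s) (u s))
        (fun s => S.A (w' s) (u s) (z s) + S.b (w' s) (u s)) (uIcc ((i : ℝ) * r) t) := by
      intro s hs
      rw [uIcc_of_le ht.1] at hs
      simp only [hww ((h0 i).trans hs.1)]
    have := h.2.1 i t ht
    exact ⟨this.1.congr (hcongr.mono uIoc_subset_uIcc),
      by rw [← intervalIntegral.integral_congr hcongr]; exact this.2⟩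
  · rw [h.2.2 i]
    exact recon_congr_ae hr (fun s hs => hww (add_nonneg (h0 i) hs.1)) .rfl

end ControlSystem

/-! ### The main theorem -/

theorem proposition3p1 {n k m : ℕ} (S : ControlSystem n k m) (r : ℝ) (hr : 0 < r)
    (hwp : S.WellPosed) (hobs : S.StronglyObservable r)
    (hbdd : S.BoundedTrajectories) (hP : S.ReconCompletelyContinuous r) :
    -- existence and uniqueness of the solution
    (∀ (x₀ : Euc n) (y₀ : Euc k) (z₀ : Euc n) (u : ℝ → Euc m) (e : ℝ → Euc k),
      MemLinf (Ici 0) S.U u → MemLinf (Ici 0) univ e →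
      ∃ (x : ℝ → Euc n) (y : ℝ → Euc k) (z : ℝ → Euc n),
        S.IsCoupledSolution r u e x₀ y₀ z₀ x y z ∧
        ∀ (x' : ℝ → Euc n) (y' : ℝ → Euc k) (z' : ℝ → Euc n),
          S.IsCoupledSolution r u e x₀ y₀ z₀ x' y' z' →
          EqOn x' x (Ici 0) ∧ EqOn y' y (Ici 0) ∧ EqOn z' z (Ici 0)) ∧
    -- (a) bounded errors give a bounded estimation error
    (∀ (x₀ : Euc n) (y₀ : Euc k) (z₀ : Euc n) (u : ℝ → Euc m) (e : ℝ → Euc k),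
      MemLinf (Ici 0) S.U u → MemLinf (Ici 0) univ e → supNormOn (Ici 0) e < ⊤ →
      ∀ (x : ℝ → Euc n) (y : ℝ → Euc k) (z : ℝ → Euc n),
        S.IsCoupledSolution r u e x₀ y₀ z₀ x y z → supNormOn (Ici 0) (z - x) < ⊤) ∧
    -- (b) small errors give a small estimation error from time `r` on
    (∀ (x₀ : Euc n) (y₀ : Euc k) (z₀ : Euc n) (u : ℝ → Euc m), MemLinf (Ici 0) S.U u →
      ∀ ε : ℝ, 0 < ε → ∃ δ : ℝ, 0 < δ ∧ ∀ e : ℝ → Euc k, MemLinf (Ici 0) univ e →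
        supNormOn (Ici 0) e < ENNReal.ofReal δ →
        ∀ (x : ℝ → Euc n) (y : ℝ → Euc k) (z : ℝ → Euc n),
          S.IsCoupledSolution r u e x₀ y₀ z₀ x y z →
          supNormOn (Ici r) (z - x) < ENNReal.ofReal ε) ∧
    -- (c) converging errors give a converging estimation error
    (∀ (x₀ : Euc n) (y₀ : Euc k) (z₀ : Euc n) (u : ℝ → Euc m) (e : ℝ → Euc k),
      MemLinf (Ici 0) S.U u → MemLinf (Ici 0) univ e → Tendsto (fun t => ‖e t‖) atTop (𝓝 0) →
      ∀ (x : ℝ → Euc n) (y : ℝ → Euc k) (z : ℝ → Euc n),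
        S.IsCoupledSolution r u e x₀ y₀ z₀ x y z →
        Tendsto (fun t => ‖z t - x t‖) atTop (𝓝 0)) := by
  have hsol : ∀ {x₀ : Euc n} {y₀ : Euc k} {u : ℝ → Euc m} {x : ℝ → Euc n} {y : ℝ → Euc k},
      MemLinf (Ici 0) S.U u → S.IsSolution (Ici 0) u x₀ y₀ x y →
      ∃ M : ℝ, 0 ≤ M ∧ (∀ t ∈ Ici (0 : ℝ), ‖x t‖ ≤ M) ∧ ∀ t ∈ Ici (0 : ℝ), ‖y t‖ ≤ M :=
    fun hu h => hbdd.exists_bound hu h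
  refine ⟨fun x₀ y₀ z₀ u e hu he => ?_, fun x₀ y₀ z₀ u e hu he heb x y z h => ?_,
    fun x₀ y₀ z₀ u hu ε hε => ?_, fun x₀ y₀ z₀ u e hu he het x y z h => ?_⟩
  · obtain ⟨x, y, hxy, huniq⟩ := hwp x₀ y₀ u hu.memLinfLoc
    obtain ⟨M, -, -, hyM⟩ := hsol hu hxy
    have hw : ∀ T, MemLp (y + e) ∞ (volume.restrict (Icc 0 T)) := fun T =>
      (((hxy.memLinf_snd hyM).add_univ he).mono Icc_subset_Ici_self).1
    obtain ⟨z, hz⟩ := ControlSystem.exists_isObserver hr hu hw z₀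
    refine ⟨x, y, z, ⟨hxy, hz⟩, fun x' y' z' h' => ?_⟩
    obtain ⟨hx', hy'⟩ := huniq x' y' h'.1
    refine ⟨hx', hy', (h'.2.congr hr.le fun t ht => ?_).eqOn hr hu hw hz⟩
    simp only [Pi.add_apply, hy' ht]
  · obtain ⟨M, hM0, hxM, hyM⟩ := hsol hu h.1
    obtain ⟨R, hR0, hR⟩ := exists_norm_le_of_supNormOn_lt_top heb
    obtain ⟨K, hK0, L, hK⟩ := ControlSystem.exists_norm_sub_le_of_bounded hr.le hu h.1 hM0 hxM
      hyM hR0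
    obtain ⟨K', hK'0, hK'⟩ := ControlSystem.exists_norm_recon_le hr.le hP hu (M + R)
    have hy := h.1.memLinf_snd hyM
    refine (supNormOn_le_ofReal (C := (‖z₀‖ + K' + M + K) * Real.exp L)
      fun t ht => ?_).trans_lt ENNReal.ofReal_lt_top
    have hti := (floor_div_eq_iff hr ht).1 rfl
    refine (hK e z₀ z h.2 _ (fun s hs => hR s ?_) t hti).trans ?_
    · exact le_trans (by positivity) hs.1
    have hstart : ‖z (⌊t / r⌋₊ * r)‖ ≤ ‖z₀‖ + K' := by
      cases ⌊t / r⌋₊ with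
      | zero => simpa [h.2.1] using hK'0
      | succ j =>
        push_cast
        rw [h.2.2.2 j]
        have hj : 0 ≤ (j : ℝ) * r := by positivity
        have := hK' (j * r) hj (y + e) (hy.add_univ he) fun s hs =>
          (norm_add_le _ _).trans (add_le_add (hyM s (hj.trans hs.1)) (hR s (hj.trans hs.1)))
        linarith [norm_nonneg z₀]
    have hx : ‖x (⌊t / r⌋₊ * r)‖ ≤ M := hxM _ (mem_Ici.2 (by positivity))
    gcongr
    exact (norm_sub_le _ _).trans (add_le_add hstart hx)
  -- `δ` must be chosen before `e` and the solution are given, so it is taken from the solution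
  -- provided by well-posedness; uniqueness identifies the two on `[0, ∞)`.
  · obtain ⟨x, y, hxy, huniq⟩ := hwp x₀ y₀ u hu.memLinfLoc
    obtain ⟨M, hM0, hxM, hyM⟩ := hsol hu hxy
    obtain ⟨δ, hδ, hsmall⟩ := ControlSystem.exists_norm_sub_le_of_small hr hobs hP hu hxy hM0 hxM
      hyM (half_pos hε)
    refine ⟨δ, hδ, fun e he heδ x' y' z h => ?_⟩
    obtain ⟨hx', hy'⟩ := huniq x' y' h.1
    have hO : S.IsObserver r u (y + e) z₀ z := h.2.congr hr.le fun t ht => by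
      simp only [Pi.add_apply, hy' ht]
    refine (supNormOn_le_ofReal (C := ε / 2) fun t ht => ?_).trans_lt
      ((ENNReal.ofReal_lt_ofReal_iff hε).2 (half_lt_self hε))
    rw [Pi.sub_apply, hx' (hr.le.trans ht)]
    exact hsmall e z₀ z he hO 0
      (fun s hs => (norm_lt_of_supNormOn_lt heδ (by simpa using hs)).le) t (by simpa using ht)
  · obtain ⟨M, hM0, hxM, hyM⟩ := hsol hu h.1
    rw [Metric.tendsto_atTop]
    intro ε hε
    obtain ⟨δ, hδ, hsmall⟩ := ControlSystem.exists_norm_sub_le_of_small hr hobs hP hu h.1 hM0 hxM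
      hyM (half_pos hε)
    obtain ⟨T, hT⟩ := eventually_atTop.1 (het.eventually (gt_mem_nhds hδ))
    -- The first sampling time not before `T`; one further window makes the reset depend only on
    -- small errors.
    have hN : T ≤ (⌈T / r⌉₊ : ℝ) * r := (div_le_iff₀ hr).1 (Nat.le_ceil _)
    refine ⟨((⌈T / r⌉₊ : ℝ) + 1) * r, fun t ht => ?_⟩
    have := hsmall e z₀ z he h.2 ⌈T / r⌉₊ (fun s hs => (hT s (hN.trans hs)).le) t ht
    rw [Real.dist_eq, sub_zero, abs_of_nonneg (norm_nonneg _)]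
    linarith
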